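/- Work over $\mathbb{C}$. Let $\tau\in\mathbb{C}$ with $\operatorname{Im}\tau>0$, $E=\mathbb{C}/(\mathbb{Z}+\mathbb{Z}\tau)$, $X=E\setminus\{0\}$, and let $H^*(X)$ be the cohomology of the algebraic de Rham complex of $X$: $X$ is the affine curve $v^2=4u^3-60G_4(\tau)u-140G_6(\tau)$ with $u=\wp(x)$, $v=\wp'(x)$, with coordinate ring $\Gamma$; its de Rham complex is $\Gamma\to\Gamma\,dx$, where $dx=du/v$. The class $[dx]\in H^1(X)$ is that of $dx$, and $[d\bar x]\in H^1(X)$ is the class of the smooth form $d\bar x$, that is, of the cohomologous algebraic form $\frac{\bar\tau-\tau}{2\pi i}(\wp(x)+G_2(\tau))\,dx+dx$. Let $n\ge 0$. *The algebra $E_2(n)$.* Let $G(n)$ be the graded commutative algebra with generators $G_{ij}$ ($1\le i\neq j\le n$) of degree $1$ and relations $G_{ij}=G_{ji}$, $G_{ij}^2=0$, and $G_{ij}G_{ik}+G_{jk}G_{ji}+G_{ki}G_{kj}=0$ for $i,j,k$ pairwise distinct. For $1\le i\le n$ let $\pi_i^*:H^*(X)\to H^*(X)^{\otimes n}$ be the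 inclusion of the $i$-th factor, and write $[dx_i]=\pi_i^*[dx]$, $[d\bar x_i]=\pi_i^*[d\bar x]$. Then $E_2(n)$ is the quotient of $H^*(X)^{\otimes n}\otimes G(n)$ by the ideal generated by all $(\pi_i^*\eta-\pi_j^*\eta)\otimes G_{ij}$, $\eta\in H^*(X)$, $i\ne j$. It is bigraded, with $\pi_i^*H^k(X)$ in bidegree $(k,0)$ and $G_{ij}$ in bidegree $(0,1)$, and its differential, of bidegree $(2,-1)$, is determined by $d|_{H^*(X)^{\otimes n}}=0$ and $$d(G_{ij})=\pi_{ij}^*\Delta=\frac{([dx_i]-[dx_j])([d\bar x_i]-[d\bar x_j])}{\bar\tau-\tau},$$ where $\Delta=\frac{1}{\bar\tau-\tau}(dx_1-dx_2)\wedge(d\bar x_1-d\bar x_2)\in H^2(X^2)$ is the class of the diagonal. Put $G_{ii}=0$. *The algebra $\Xi_n$.* This is the graded commutative algebra with generators $\omega_i,\nu_i$ ($1\le i\le n$) and $\omega_{ij}^{(m)}$ ($1\le i,j\le n$, $m\ge0$), all of degree $1$, and relations $\omega_{ij}^{(m)}+(-1)^m\omega_{ji}^{(m)}=0$, $\omega_{ij}^{(0)}=\omega_i-\omega_j$,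 together with the relations given, for all $i,j,\ell$, by the coefficients in $\alpha,\beta$ of $$\Omega_{i\ell}(\alpha)\Omega_{j\ell}(\beta)+\Omega_{ji}(\beta)\Omega_{i\ell}(\alpha+\beta)+\Omega_{j\ell}(\alpha+\beta)\Omega_{ij}(\alpha)=0,\qquad \Omega_{ij}(\alpha)=\sum_{m\ge0}\omega_{ij}^{(m)}\alpha^{m-1}$$ (after multiplication by $\alpha\beta(\alpha+\beta)$, which clears the negative powers). Its differential is determined by $d\omega_i=d\nu_i=0$ and $d\omega_{ij}^{(m+1)}=(\nu_i-\nu_j)\,\omega_{ij}^{(m)}$ for $m\ge0$. **Proposition.** There is exactly one differential as described on each of $\Xi_n$ and $E_2(n)$, and it makes the algebra (with its total grading) a commutative dg-algebra. The assignments $$\psi(\nu_i)=-\frac{[d\bar x_i]}{\bar\tau-\tau},\quad \psi(\omega_i)=[dx_i],\quad \psi(\omega_{ij}^{(0)})=[dx_i]-[dx_j],\quad \psi(\omega_{ij}^{(1)})=G_{ij},\quad \psi(\omega_{ij}^{(m)})=0\ (m\ge2)$$ extend to a (unique) morphism of dg-algebras $\psi:\Xi_n\to E_2(n)$. -/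

import Mathlib

open scoped UpperHalfPlane

noncomputable section

namespace ChiralHodge

/-! ### Graded commutative algebras given by generators and relations -/

section Presented

variable {X : Type} (deg : X → ℕ) (rels : Set (FreeAlgebra ℂ X))

/-- The relations imposed on the free algebra on `X`: graded commutativity of the generators,
and the vanishing of the elements of `rels`. -/
inductive GCRel : FreeAlgebra ℂ X → FreeAlgebra ℂ X → Prop
  | comm (x y : X) : GCRel (FreeAlgebra.ι ℂ x * FreeAlgebra.ι ℂ y)
      ((-1 : ℂ) ^ (deg x * deg y) • (FreeAlgebra.ι ℂ y * FreeAlgebra.ι ℂ x))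
  | rel (a : FreeAlgebra ℂ X) (ha : a ∈ rels) : GCRel a 0

/-- The graded commutative algebra over `ℂ` with generators `x : X` of degree `deg x` and
relations `a = 0` for `a ∈ rels`. -/
abbrev GCAlg : Type := RingQuot (GCRel deg rels)

/-- The class of a generator. -/
def GCAlg.gen (x : X) : GCAlg deg rels :=
  RingQuot.mkAlgHom ℂ (GCRel deg rels) (FreeAlgebra.ι ℂ x)

/-- For a degree function `deg'` on generators with values in an additive monoid `M`, the
subspace of degree `m : M`: the span of the products of generators whose degrees add up to `m`.
With `deg' = deg` this is the grading of the algebra. -/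
def GCAlg.piece {M : Type} [AddMonoid M] (deg' : X → M) (m : M) :
    Submodule ℂ (GCAlg deg rels) :=
  Submodule.span ℂ {a | ∃ w : List X, (w.map deg').sum = m ∧
    a = (w.map (GCAlg.gen deg rels)).prod}

end Presented

/-! ### Commutative dg-algebras -/

/-- `(A, 𝒜, d)` is a commutative dg-algebra over `ℂ` (with differential of degree `+1`). -/
structure IsCDGA {A : Type} [Ring A] [Algebra ℂ A] (𝒜 : ℕ → Submodule ℂ A) (d : A →ₗ[ℂ] A) :
    Prop where
  gradedMonoid : SetLike.GradedMonoid 𝒜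
  isInternal : DirectSum.IsInternal 𝒜
  comm : ∀ p q : ℕ, ∀ a ∈ 𝒜 p, ∀ b ∈ 𝒜 q, a * b = (-1 : ℂ) ^ (p * q) • (b * a)
  map_deg : ∀ p : ℕ, ∀ a ∈ 𝒜 p, d a ∈ 𝒜 (p + 1)
  leibniz : ∀ p : ℕ, ∀ a ∈ 𝒜 p, ∀ b : A, d (a * b) = d a * b + (-1 : ℂ) ^ p • (a * d b)
  d_d : ∀ a : A, d (d a) = 0

/-- The algebra homomorphism `f` is a morphism of dg-algebras: it preserves degrees and commutes
with the differentials. -/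
structure IsDGMorphism {A B : Type} [Ring A] [Algebra ℂ A] [Ring B] [Algebra ℂ B]
    (𝒜 : ℕ → Submodule ℂ A) (dA : A →ₗ[ℂ] A) (ℬ : ℕ → Submodule ℂ B) (dB : B →ₗ[ℂ] B)
    (f : A →ₐ[ℂ] B) : Prop where
  map_deg : ∀ p : ℕ, ∀ a ∈ 𝒜 p, f a ∈ ℬ p
  comm_d : ∀ a : A, f (dA a) = dB (f a)

/-! ### The affine curve `X = E \ {0}`, `E = ℂ / (ℤ + ℤ τ)`, and its de Rham cohomology -/

/-- The periods `1, τ`. -/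
def periods (τ : ℍ) : PeriodPair where
  ω₁ := 1
  ω₂ := (τ : ℂ)
  indep := by
    rw [LinearIndependent.pair_iff]
    intro s t h
    have him := congrArg Complex.im h
    have hre := congrArg Complex.re h
    have ht : t = 0 := by
      have : t * τ.im = 0 := by simpa using him
      exact (mul_eq_zero.mp this).resolve_right τ.im_pos.ne'
    subst ht
    exact ⟨by simpa using hre, rfl⟩

/-- The equation `v² - (4 u³ - g₂ u - g₃)` of `X`, where `u = X 0`, `v = X 1`, and
`g₂ = 60 G₄(τ)`, `g₃ = 140 G₆(τ)`. -/
def curveEqn (τ : ℍ) : MvPolynomial (Fin 2) ℂ :=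
  MvPolynomial.X 1 ^ 2 - (4 * MvPolynomial.X 0 ^ 3
    - MvPolynomial.C (periods τ).g₂ * MvPolynomial.X 0 - MvPolynomial.C (periods τ).g₃)

/-- The coordinate ring of `X`; the classes of `u` and `v` are the functions `℘(x)`, `℘'(x)`. -/
def CoordRing (τ : ℍ) : Type := MvPolynomial (Fin 2) ℂ ⧸ Ideal.span {curveEqn τ}

instance (τ : ℍ) : CommRing (CoordRing τ) :=
  inferInstanceAs (CommRing (MvPolynomial (Fin 2) ℂ ⧸ Ideal.span {curveEqn τ}))

instance (τ : ℍ) : Algebra ℂ (CoordRing τ) :=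
  inferInstanceAs (Algebra ℂ (MvPolynomial (Fin 2) ℂ ⧸ Ideal.span {curveEqn τ}))

/-- The quotient map `ℂ[u, v] → Γ`. -/
def CoordRing.mk (τ : ℍ) : MvPolynomial (Fin 2) ℂ →ₐ[ℂ] CoordRing τ :=
  Ideal.Quotient.mkₐ ℂ (Ideal.span {curveEqn τ})

/-- The function `u = ℘(x)` on `X`. -/
def wp (τ : ℍ) : CoordRing τ := CoordRing.mk τ (MvPolynomial.X 0)

/-- The derivation `v ∂_u + (P'(u) / 2) ∂_v` of `ℂ[u, v]`, where `P(u) = 4 u³ - g₂ u - g₃`. -/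
def polyDer (τ : ℍ) : Derivation ℂ (MvPolynomial (Fin 2) ℂ) (MvPolynomial (Fin 2) ℂ) :=
  MvPolynomial.mkDerivation ℂ
    ![MvPolynomial.X 1,
      6 * MvPolynomial.X 0 ^ 2 - MvPolynomial.C ((periods τ).g₂ / 2)]

lemma polyDer_curveEqn (τ : ℍ) : polyDer τ (curveEqn τ) = 0 := by
  have h0 : polyDer τ (MvPolynomial.X 0) = MvPolynomial.X 1 := by
    simp [polyDer, MvPolynomial.mkDerivation_X]
  have h1 : polyDer τ (MvPolynomial.X 1)
      = 6 * MvPolynomial.X 0 ^ 2 - MvPolynomial.C ((periods τ).g₂ / 2) := by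
    simp [polyDer, MvPolynomial.mkDerivation_X]
  have h4 : polyDer τ (4 : MvPolynomial (Fin 2) ℂ) = 0 := by
    exact_mod_cast (polyDer τ).map_natCast 4
  have hC : ∀ c : ℂ, polyDer τ (MvPolynomial.C c) = 0 := fun c =>
    (polyDer τ).map_algebraMap c
  have h2 : (MvPolynomial.C (periods τ).g₂ : MvPolynomial (Fin 2) ℂ)
      = 2 * MvPolynomial.C ((periods τ).g₂ / 2) := by
    rw [show (2 : MvPolynomial (Fin 2) ℂ) = MvPolynomial.C 2 from (map_ofNat _ 2).symm,
      ← MvPolynomial.C_mul]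
    congr 1
    ring
  simp only [curveEqn, map_sub, Derivation.leibniz, Derivation.leibniz_pow, h0, h1, h4, hC,
    smul_eq_mul, nsmul_eq_mul]
  rw [h2]
  push_cast
  ring

lemma polyDer_mem (τ : ℍ) (a : MvPolynomial (Fin 2) ℂ) (ha : a ∈ Ideal.span {curveEqn τ}) :
    polyDer τ a ∈ Ideal.span {curveEqn τ} := by
  obtain ⟨b, rfl⟩ := Ideal.mem_span_singleton'.mp ha
  rw [Derivation.leibniz, polyDer_curveEqn, smul_zero, zero_add, smul_eq_mul]
  exact Ideal.mul_mem_right _ _ (Ideal.subset_span rfl)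

/-- The derivation `∂_x = v ∂_u + (P'(u) / 2) ∂_v` of the coordinate ring of `X`. -/
def der (τ : ℍ) : Derivation ℂ (CoordRing τ) (CoordRing τ) :=
  Derivation.liftOfSurjective (f := CoordRing.mk τ)
    (d := polyDer τ) (Ideal.Quotient.mkₐ_surjective ℂ _)
    (fun a ha => by
      have h : a ∈ Ideal.span {curveEqn τ} := Ideal.Quotient.eq_zero_iff_mem.mp ha
      exact Ideal.Quotient.eq_zero_iff_mem.mpr (polyDer_mem τ a h))

section DeRham

/-! For a `ℂ`-algebra `Γ` with a derivation `D`, the differential graded algebra `Γ ⊕ Γ dx` with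
`dx ∧ dx = 0` and `d f = D(f) dx`, realised as the trivial square-zero extension of `Γ` by `Γ`. -/

variable {Γ : Type} [CommRing Γ] [Algebra ℂ Γ] (D : Derivation ℂ Γ Γ)

/-- The differential `d (f + g dx) = D(f) dx`. -/
def formD : TrivSqZeroExt Γ Γ →ₗ[ℂ] TrivSqZeroExt Γ Γ where
  toFun a := TrivSqZeroExt.inr (D a.fst)
  map_add' a b := by rw [TrivSqZeroExt.fst_add, map_add, TrivSqZeroExt.inr_add]
  map_smul' c a := by
    rw [TrivSqZeroExt.fst_smul, Derivation.map_smul, TrivSqZeroExt.inr_smul, RingHom.id_apply]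

variable (Γ) in
/-- The forms of degree `k`. -/
def formsOfDegree : ℕ → Set (TrivSqZeroExt Γ Γ)
  | 0 => Set.range TrivSqZeroExt.inl
  | 1 => Set.range TrivSqZeroExt.inr
  | _ => {0}

/-- The algebra of closed forms. -/
def closedForms : Subalgebra ℂ (TrivSqZeroExt Γ Γ) where
  carrier := {a | formD D a = 0}
  mul_mem' {a b} ha hb := by
    have ha' : D a.fst = 0 := TrivSqZeroExt.inr_injective ha
    have hb' : D b.fst = 0 := TrivSqZeroExt.inr_injective hb
    change TrivSqZeroExt.inr (D (a * b).fst) = 0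
    rw [TrivSqZeroExt.fst_mul, Derivation.leibniz, ha', hb', smul_zero, smul_zero, add_zero,
      TrivSqZeroExt.inr_zero]
  add_mem' {a b} ha hb := by
    change formD D a = 0 at ha
    change formD D b = 0 at hb
    change formD D (a + b) = 0
    rw [map_add, ha, hb, add_zero]
  algebraMap_mem' c := by
    change TrivSqZeroExt.inr (D (algebraMap ℂ Γ c)) = 0
    rw [Derivation.map_algebraMap, TrivSqZeroExt.inr_zero]

/-- The ideal of exact forms in the algebra of closed forms. -/
def exactForms : Ideal (closedForms D) where
  carrier := {a | ∃ b, (a : TrivSqZeroExt Γ Γ) = formD D b}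
  zero_mem' := ⟨0, by rw [map_zero]; rfl⟩
  add_mem' := by
    rintro a b ⟨a', ha⟩ ⟨b', hb⟩
    exact ⟨a' + b', by rw [map_add, ← ha, ← hb]; rfl⟩
  smul_mem' := by
    rintro c a ⟨b, hb⟩
    have hc : D (c : TrivSqZeroExt Γ Γ).fst = 0 := TrivSqZeroExt.inr_injective c.2
    refine ⟨c * b, ?_⟩
    change (c : TrivSqZeroExt Γ Γ) * (a : TrivSqZeroExt Γ Γ) = _
    rw [hb]
    change _ = TrivSqZeroExt.inr (D ((c : TrivSqZeroExt Γ Γ).fst * b.fst))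
    change (c : TrivSqZeroExt Γ Γ) * TrivSqZeroExt.inr (D b.fst) = _
    rw [Derivation.leibniz, hc, smul_zero, add_zero]
    apply TrivSqZeroExt.ext
    · simp only [TrivSqZeroExt.fst_mul, TrivSqZeroExt.fst_inr, mul_zero]
    · simp only [TrivSqZeroExt.snd_mul, TrivSqZeroExt.fst_inr, TrivSqZeroExt.snd_inr,
        MulOpposite.op_zero, zero_smul, add_zero]

/-- The cohomology algebra: closed forms modulo exact forms. -/
def FormCoh : Type := closedForms D ⧸ exactForms D

instance : CommRing (FormCoh D) := inferInstanceAs (CommRing (closedForms D ⧸ exactForms D))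

instance : Algebra ℂ (FormCoh D) := inferInstanceAs (Algebra ℂ (closedForms D ⧸ exactForms D))

/-- The cohomology class of a closed form. -/
def FormCoh.mk : closedForms D →ₐ[ℂ] FormCoh D := Ideal.Quotient.mkₐ ℂ (exactForms D)

/-- The cohomology classes of degree `k`: the classes of closed forms of degree `k`. -/
def formCohPiece (k : ℕ) : Submodule ℂ (FormCoh D) :=
  Submodule.span ℂ {c | ∃ a : closedForms D, (a : TrivSqZeroExt Γ Γ) ∈ formsOfDegree Γ k ∧
    c = FormCoh.mk D a}

/-- The class `[f dx]` of degree one. -/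
def formClass (f : Γ) : formCohPiece D 1 :=
  ⟨FormCoh.mk D
      ⟨TrivSqZeroExt.inr f, by
        change TrivSqZeroExt.inr (D (TrivSqZeroExt.inr f : TrivSqZeroExt Γ Γ).fst) = 0
        rw [TrivSqZeroExt.fst_inr, map_zero, TrivSqZeroExt.inr_zero]⟩,
    Submodule.subset_span ⟨_, ⟨f, rfl⟩, rfl⟩⟩

end DeRham

/-- The cohomology algebra `H^*(X)` of the algebraic de Rham complex of `X`. The module of Kähler
differentials of the smooth affine curve `X` is free on the invariant form `dx = du / v`, so this
complex is `Γ ⊕ Γ dx` with `d f = (∂_x f) dx`, where `Γ` is the coordinate ring. -/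
abbrev Coh (τ : ℍ) : Type := FormCoh (der τ)

/-- `H^k(X)`. -/
abbrev cohPiece (τ : ℍ) (k : ℕ) : Submodule ℂ (Coh τ) := formCohPiece (der τ) k

/-- The class `[dx]`. -/
def dx (τ : ℍ) : cohPiece τ 1 := formClass (der τ) 1

/-- `τ̄ - τ`. -/
def cvol (τ : ℍ) : ℂ := (starRingEnd ℂ) (τ : ℂ) - (τ : ℂ)

/-- The class `[dx̄]`. The smooth function `ζ(x) + 2πi (x̄ - x) / (τ̄ - τ)` on `X`, in which
`ζ' = -℘ - G₂(τ)`, `ζ(x + 1) = ζ(x)`, `ζ(x + τ) = ζ(x) - 2πi`, shows that the form `dx̄` is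
cohomologous to the algebraic form `((τ̄ - τ) / 2πi) (℘(x) + G₂(τ)) dx + dx`. -/
def dxbar (τ : ℍ) : cohPiece τ 1 :=
  formClass (der τ) ((cvol τ / (2 * Real.pi * Complex.I)) •
    (wp τ + algebraMap ℂ (CoordRing τ) (EisensteinSeries.G2 τ)) + 1)

/-! ### Totaro's algebra `E_2(n)` -/

section Totaro

/-! Here `ℋ` is the grading of a graded commutative algebra `H`, below `H = H^*(X)`. -/

variable {H : Type} [CommRing H] [Algebra ℂ H] (ℋ : ℕ → Submodule ℂ H) (n : ℕ)

/-- Generators of `E_2(n)`: the elements `π_i^* η` for `η ∈ H^k`, and `G_ij` for `i ≠ j`. -/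
inductive E2Gen : Type
  | pull (i : Fin n) (k : ℕ) (η : ℋ k)
  | G (i j : Fin n) (hij : i ≠ j)

variable {ℋ n} in
/-- The bidegree: `π_i^* H^k` has bidegree `(k, 0)`, and `G_ij` has bidegree `(0, 1)`. -/
def E2Gen.bideg : E2Gen ℋ n → ℕ × ℕ
  | .pull _ k _ => (k, 0)
  | .G _ _ _ => (0, 1)

variable {ℋ n} in
/-- The total degree. -/
def E2Gen.deg (x : E2Gen ℋ n) : ℕ := x.bideg.1 + x.bideg.2

open E2Gen in
/-- The relations of `E_2(n)`. The first four, with graded commutativity, present `H^{⊗ n}`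
(each `π_i^*` is a homomorphism of algebras), the next three present the algebra `G(n)`, and the
last one identifies `π_i^* η` and `π_j^* η` after multiplication with `G_ij`. -/
inductive E2Rel : FreeAlgebra ℂ (E2Gen ℋ n) → Prop
  | pull_add (i : Fin n) (k : ℕ) (η θ : ℋ k) :
      E2Rel (FreeAlgebra.ι ℂ (pull i k (η + θ))
        - (FreeAlgebra.ι ℂ (pull i k η) + FreeAlgebra.ι ℂ (pull i k θ)))
  | pull_smul (i : Fin n) (k : ℕ) (c : ℂ) (η : ℋ k) :
      E2Rel (FreeAlgebra.ι ℂ (pull i k (c • η)) - c • FreeAlgebra.ι ℂ (pull i k η))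
  | pull_one (i : Fin n) (η : ℋ 0) (hη : (η : H) = 1) :
      E2Rel (FreeAlgebra.ι ℂ (pull i 0 η) - 1)
  | pull_mul (i : Fin n) (k l : ℕ) (η : ℋ k) (θ : ℋ l)
      (ξ : ℋ (k + l)) (hξ : (ξ : H) = (η : H) * (θ : H)) :
      E2Rel (FreeAlgebra.ι ℂ (pull i (k + l) ξ)
        - FreeAlgebra.ι ℂ (pull i k η) * FreeAlgebra.ι ℂ (pull i l θ))
  | G_symm (i j : Fin n) (hij : i ≠ j) :
      E2Rel (FreeAlgebra.ι ℂ (G i j hij) - FreeAlgebra.ι ℂ (G j i hij.symm))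
  | G_sq (i j : Fin n) (hij : i ≠ j) :
      E2Rel (FreeAlgebra.ι ℂ (G i j hij) * FreeAlgebra.ι ℂ (G i j hij))
  | G_arnold (i j k : Fin n) (hij : i ≠ j) (hjk : j ≠ k) (hki : k ≠ i) :
      E2Rel (FreeAlgebra.ι ℂ (G i j hij) * FreeAlgebra.ι ℂ (G i k hki.symm)
        + FreeAlgebra.ι ℂ (G j k hjk) * FreeAlgebra.ι ℂ (G j i hij.symm)
        + FreeAlgebra.ι ℂ (G k i hki) * FreeAlgebra.ι ℂ (G k j hjk.symm))
  | G_pull (i j : Fin n) (hij : i ≠ j) (k : ℕ) (η : ℋ k) :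
      E2Rel ((FreeAlgebra.ι ℂ (pull i k η) - FreeAlgebra.ι ℂ (pull j k η))
        * FreeAlgebra.ι ℂ (G i j hij))

/-- The quotient of `H^{⊗ n} ⊗ G(n)` by the ideal generated by `(π_i^* η - π_j^* η) ⊗ G_ij`. -/
abbrev TotaroAlg : Type := GCAlg (E2Gen.deg (ℋ := ℋ) (n := n)) {a | E2Rel ℋ n a}

namespace TotaroAlg

/-- The grading by total degree. -/
def grading : ℕ → Submodule ℂ (TotaroAlg ℋ n) := GCAlg.piece _ _ E2Gen.deg

/-- The bigrading. -/
def bigrading : ℕ × ℕ → Submodule ℂ (TotaroAlg ℋ n) := GCAlg.piece _ _ E2Gen.bideg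

variable {n}

variable {ℋ} in
/-- The element `π_i^* η`. -/
def pull (i : Fin n) {k : ℕ} (η : ℋ k) : TotaroAlg ℋ n := GCAlg.gen _ _ (E2Gen.pull i k η)

/-- The element `G_ij`, with the convention `G_ii = 0`. -/
def G (i j : Fin n) : TotaroAlg ℋ n :=
  if hij : i ≠ j then GCAlg.gen _ _ (E2Gen.G i j hij) else 0

end TotaroAlg

end Totaro

/-- The algebra `E_2(n)`, the quotient of `H^*(X)^{⊗ n} ⊗ G(n)` by the ideal generated by
`(π_i^* η - π_j^* η) ⊗ G_ij`, for `η ∈ H^*(X)`. -/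
abbrev E2 (τ : ℍ) (n : ℕ) : Type := TotaroAlg (cohPiece τ) n

namespace E2

variable {τ : ℍ} {n : ℕ}

/-- The element `π_i^* η` of `E_2(n)`. -/
abbrev pull (i : Fin n) {k : ℕ} (η : cohPiece τ k) : E2 τ n := TotaroAlg.pull i η

variable (τ) in
/-- The element `G_ij` of `E_2(n)`, with the convention `G_ii = 0`. -/
abbrev G (i j : Fin n) : E2 τ n := TotaroAlg.G (cohPiece τ) i j

variable (τ n) in
/-- The grading of `E_2(n)` by total degree. -/
abbrev grading : ℕ → Submodule ℂ (E2 τ n) := TotaroAlg.grading (cohPiece τ) n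

variable (τ n) in
/-- The bigrading of `E_2(n)`. -/
abbrev bigrading : ℕ × ℕ → Submodule ℂ (E2 τ n) := TotaroAlg.bigrading (cohPiece τ) n

variable (τ) in
/-- The pullback `π_ij^* Δ` of the class of the diagonal
`Δ = (dx₁ - dx₂) (dx̄₁ - dx̄₂) / (τ̄ - τ)`. -/
def diag (i j : Fin n) : E2 τ n :=
  (cvol τ)⁻¹ • ((pull i (dx τ) - pull j (dx τ)) * (pull i (dxbar τ) - pull j (dxbar τ)))

variable (τ n) in
/-- `d` is the differential of `E_2(n)`: it makes `E_2(n)` a commutative dg-algebra, has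
bidegree `(2, -1)`, vanishes on `H^*(X)^{⊗ n}`, and maps `G_ij` to `π_ij^* Δ`. -/
structure IsDifferential (d : E2 τ n →ₗ[ℂ] E2 τ n) : Prop where
  isCDGA : IsCDGA (grading τ n) d
  bideg : ∀ p q : ℕ, ∀ a ∈ bigrading τ n (p, q + 1), d a ∈ bigrading τ n (p + 2, q)
  bideg_zero : ∀ p : ℕ, ∀ a ∈ bigrading τ n (p, 0), d a = 0
  d_G : ∀ i j : Fin n, i ≠ j → d (G τ i j) = diag τ i j

end E2

/-! ### The algebra `Ξ_n` -/

/-- Generators of `Ξ_n`: `ω_i`, `ν_i` and `ω_ij^{(m)}`. -/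
inductive XiGen (n : ℕ) : Type
  | om (i : Fin n)
  | nu (i : Fin n)
  | omm (i j : Fin n) (m : ℕ)

/-- All generators have degree one. -/
def XiGen.deg {n : ℕ} (_ : XiGen n) : ℕ := 1

section Series

variable {R : Type} [Ring R] (w : ℕ → R)

/-- `∑ w_m α^m` as a power series in `α = X 0` and `β = X 1`. -/
def serA : MvPowerSeries (Fin 2) R := fun e => if e 1 = 0 then w (e 0) else 0

/-- `∑ w_m β^m` as a power series in `α = X 0` and `β = X 1`. -/
def serB : MvPowerSeries (Fin 2) R := fun e => if e 0 = 0 then w (e 1) else 0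

/-- `∑ w_m (α + β)^m` as a power series in `α = X 0` and `β = X 1`. -/
def serAB : MvPowerSeries (Fin 2) R := fun e => (e 0 + e 1).choose (e 0) • w (e 0 + e 1)

end Series

/-- The sequence `(ω_ij^{(m)})_m`, the coefficients of `α Ω_ij(α)`. -/
def XiGen.seq {n : ℕ} (i j : Fin n) (m : ℕ) : FreeAlgebra ℂ (XiGen n) :=
  FreeAlgebra.ι ℂ (XiGen.omm i j m)

open XiGen in
/-- The series `Ω_il(α) Ω_jl(β) + Ω_ji(β) Ω_il(α + β) + Ω_jl(α + β) Ω_ij(α)`, multiplied by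
`α β (α + β)` in order to clear negative powers, where `Ω_ij(α) = ∑ ω_ij^{(m)} α^{m-1}`. -/
def fay {n : ℕ} (i j l : Fin n) : MvPowerSeries (Fin 2) (FreeAlgebra ℂ (XiGen n)) :=
  (MvPowerSeries.X 0 + MvPowerSeries.X 1) * (serA (seq i l) * serB (seq j l))
    + MvPowerSeries.X 0 * (serB (seq j i) * serAB (seq i l))
    + MvPowerSeries.X 1 * (serAB (seq j l) * serA (seq i j))

open XiGen in
/-- The relations of `Ξ_n`. -/
inductive XiRel (n : ℕ) : FreeAlgebra ℂ (XiGen n) → Prop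
  | symm (i j : Fin n) (m : ℕ) :
      XiRel n (FreeAlgebra.ι ℂ (omm i j m) + (-1 : ℂ) ^ m • FreeAlgebra.ι ℂ (omm j i m))
  | zero (i j : Fin n) :
      XiRel n (FreeAlgebra.ι ℂ (omm i j 0) - (FreeAlgebra.ι ℂ (om i) - FreeAlgebra.ι ℂ (om j)))
  | fay (i j l : Fin n) (e : Fin 2 →₀ ℕ) : XiRel n (MvPowerSeries.coeff e (fay i j l))

/-- The algebra `Ξ_n`. -/
abbrev Xi (n : ℕ) : Type := GCAlg (XiGen.deg (n := n)) {a | XiRel n a}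

namespace Xi

variable {n : ℕ}

/-- The generator `ω_i`. -/
def om (i : Fin n) : Xi n := GCAlg.gen _ _ (XiGen.om i)

/-- The generator `ν_i`. -/
def nu (i : Fin n) : Xi n := GCAlg.gen _ _ (XiGen.nu i)

/-- The generator `ω_ij^{(m)}`. -/
def omm (i j : Fin n) (m : ℕ) : Xi n := GCAlg.gen _ _ (XiGen.omm i j m)

variable (n) in
/-- The grading of `Ξ_n`. -/
def grading : ℕ → Submodule ℂ (Xi n) := GCAlg.piece _ _ XiGen.deg

variable (n) in
/-- `d` is the differential of `Ξ_n`. -/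
structure IsDifferential (d : Xi n →ₗ[ℂ] Xi n) : Prop where
  isCDGA : IsCDGA (grading n) d
  d_om : ∀ i : Fin n, d (om i) = 0
  d_nu : ∀ i : Fin n, d (nu i) = 0
  d_omm : ∀ (i j : Fin n) (m : ℕ), d (omm i j (m + 1)) = (nu i - nu j) * omm i j m

end Xi

end ChiralHodge

end

/-! Both algebras are presented by generators and homogeneous relations, so everything reduces to
generators. The prescribed values define a derivation on the free algebra with values in the
quotient, namely the upper right corner of a homomorphism to triangular matrices. It descends to the
quotient exactly when it kills the relations (`GCAlg.exists_derivation`). The condition d² = 0, the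
uniqueness of d and compatibility with ψ are then checked on generators.

For Ξ_n the differential reads dΩ_ij(α) = α(ν_i - ν_j)Ω_ij(α). The three products in the Fay
relation all have the same logarithmic derivative, α(ν_i - ν_l) + β(ν_j - ν_l). Hence d of the
relation is a multiple of the relation, which is zero in Ξ_n (`Xi.serD_fay`).

For E_2(n), write Δ_ij for the pullback of the diagonal class. Next to G_ik the indices i and k are
interchangeable, so Δ_ij G_ik = Δ_kj G_ik, and d of the Arnold relation cancels in pairs
(`E2.diag_mul_G`). The relation between G_ij and the pullbacks requires (π_i^*η - π_j^*η)Δ_ij = 0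
(`E2.pull_sub_pull_mul_diag`). This is the one point where the cohomology of the curve enters: H^0 =
ℂ, H^1 is spanned by [dx] and [dx̄], and H^k = 0 for k ≥ 2. The first two facts come from the normal
form p(u) + q(u)v of functions and from reduction of powers of u modulo derivatives.

Under ψ the series αΩ_ij(α) becomes a_ij + αG_ij with a_ij = [dx_i] - [dx_j]. The Fay relation then
splits into six identities: five follow from a_ij + a_jl = a_il, anticommutativity and a_ij G_ij =
0, and the sixth is the Arnold relation (`E2.fay_ommSeq`). -/

noncomputable section

namespace ChiralHodge

/-! ### Graded commutative algebras by generators and relations, and their derivations -/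

namespace GCAlg

variable {X : Type} {deg : X → ℕ} {rels : Set (FreeAlgebra ℂ X)}

variable (deg rels) in
/-- The quotient map from the free algebra. -/
def mk : FreeAlgebra ℂ X →ₐ[ℂ] GCAlg deg rels := RingQuot.mkAlgHom ℂ (GCRel deg rels)

@[simp] lemma mk_ι (x : X) : mk deg rels (FreeAlgebra.ι ℂ x) = gen deg rels x := rfl

lemma mk_surjective : Function.Surjective (mk deg rels) := RingQuot.mkAlgHom_surjective ℂ _

lemma mk_eq_zero {a : FreeAlgebra ℂ X} (ha : a ∈ rels) : mk deg rels a = 0 := by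
  have h := RingQuot.mkAlgHom_rel ℂ (GCRel.rel (deg := deg) a ha)
  rwa [map_zero] at h

lemma gen_mul_gen (x y : X) : gen deg rels x * gen deg rels y
    = (-1 : ℂ) ^ (deg x * deg y) • (gen deg rels y * gen deg rels x) := by
  have h := RingQuot.mkAlgHom_rel ℂ (GCRel.comm (deg := deg) (rels := rels) x y)
  rwa [map_mul, map_smul, map_mul] at h

/-- The homomorphism determined by the images of the generators. -/
def lift {B : Type} [Ring B] [Algebra ℂ B] (f : X → B)
    (hcomm : ∀ x y, f x * f y = (-1 : ℂ) ^ (deg x * deg y) • (f y * f x))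
    (hrel : ∀ a ∈ rels, FreeAlgebra.lift ℂ f a = 0) : GCAlg deg rels →ₐ[ℂ] B :=
  RingQuot.liftAlgHom ℂ ⟨FreeAlgebra.lift ℂ f, by
    intro a b h
    cases h with
    | comm x y => simpa using hcomm x y
    | rel a ha => rw [hrel a ha, map_zero]⟩

lemma lift_mk {B : Type} [Ring B] [Algebra ℂ B] (f : X → B)
    (hcomm : ∀ x y, f x * f y = (-1 : ℂ) ^ (deg x * deg y) • (f y * f x))
    (hrel : ∀ a ∈ rels, FreeAlgebra.lift ℂ f a = 0) (a : FreeAlgebra ℂ X) :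
    lift f hcomm hrel (mk deg rels a) = FreeAlgebra.lift ℂ f a :=
  RingQuot.liftAlgHom_mkAlgHom_apply ℂ _ _ _

@[simp] lemma lift_gen {B : Type} [Ring B] [Algebra ℂ B] (f : X → B)
    (hcomm : ∀ x y, f x * f y = (-1 : ℂ) ^ (deg x * deg y) • (f y * f x))
    (hrel : ∀ a ∈ rels, FreeAlgebra.lift ℂ f a = 0) (x : X) :
    lift f hcomm hrel (gen deg rels x) = f x := by
  rw [← mk_ι, lift_mk, FreeAlgebra.lift_ι_apply]

lemma algHom_ext {B : Type} [Ring B] [Algebra ℂ B] {f g : GCAlg deg rels →ₐ[ℂ] B}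
    (h : ∀ x, f (gen deg rels x) = g (gen deg rels x)) : f = g := by
  apply RingQuot.ringQuot_ext'
  apply FreeAlgebra.hom_ext
  funext x
  exact h x

/-! #### Words -/

variable (deg rels) in
/-- The product of a list of generators. -/
def word (w : List X) : GCAlg deg rels := (w.map (gen deg rels)).prod

@[simp] lemma word_nil : word deg rels [] = 1 := rfl

@[simp] lemma word_cons (x : X) (w : List X) :
    word deg rels (x :: w) = gen deg rels x * word deg rels w := by simp [word]

lemma word_append (v w : List X) :
    word deg rels (v ++ w) = word deg rels v * word deg rels w := by simp [word]

section Piece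

variable {M : Type} [AddMonoid M] {deg' : X → M}

lemma word_mem_piece (w : List X) : word deg rels w ∈ piece deg rels deg' (w.map deg').sum :=
  Submodule.subset_span ⟨w, rfl, rfl⟩

lemma gen_mem_piece (x : X) : gen deg rels x ∈ piece deg rels deg' (deg' x) := by
  have := word_mem_piece (deg := deg) (rels := rels) (deg' := deg') [x]
  simpa using this

lemma one_mem_piece : (1 : GCAlg deg rels) ∈ piece deg rels deg' 0 :=
  word_mem_piece (deg' := deg') []

lemma piece_induction {m : M} {P : GCAlg deg rels → Prop}
    (word : ∀ w : List X, (w.map deg').sum = m → P (word deg rels w)) (zero : P 0)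
    (add : ∀ a b, P a → P b → P (a + b)) (smul : ∀ (c : ℂ) a, P a → P (c • a))
    {a : GCAlg deg rels} (ha : a ∈ piece deg rels deg' m) : P a := by
  induction ha using Submodule.span_induction with
  | mem a h => obtain ⟨w, hw, rfl⟩ := h; exact word w hw
  | zero => exact zero
  | add a b _ _ h h' => exact add a b h h'
  | smul c a _ h => exact smul c a h

lemma mul_mem_piece {m m' : M} {a b : GCAlg deg rels} (ha : a ∈ piece deg rels deg' m)
    (hb : b ∈ piece deg rels deg' m') : a * b ∈ piece deg rels deg' (m + m') := by
  refine piece_induction (P := fun a => a * b ∈ piece deg rels deg' (m + m'))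
    (fun w hw => ?_) (by simp) (fun a a' h h' => ?_) (fun c a h => ?_) ha
  · refine piece_induction (P := fun b => word deg rels w * b ∈ piece deg rels deg' (m + m'))
      (fun w' hw' => ?_) (by simp) (fun a a' h h' => ?_) (fun c a h => ?_) hb
    · rw [← word_append, ← hw, ← hw', ← List.sum_append, ← List.map_append]
      exact word_mem_piece _
    · rw [mul_add]; exact add_mem h h'
    · rw [mul_smul_comm]; exact Submodule.smul_mem _ _ h
  · rw [add_mul]; exact add_mem h h'
  · rw [smul_mul_assoc]; exact Submodule.smul_mem _ _ h

lemma gradedMonoid_piece : SetLike.GradedMonoid (piece deg rels deg') where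
  one_mem := one_mem_piece
  mul_mem _ _ _ _ := mul_mem_piece

end Piece

/-- Each statement that is linear holds if it holds for words. -/
lemma word_induction {P : GCAlg deg rels → Prop} (word : ∀ w : List X, P (word deg rels w))
    (add : ∀ a b, P a → P b → P (a + b)) (smul : ∀ (c : ℂ) a, P a → P (c • a))
    (a : GCAlg deg rels) : P a := by
  have hspan : ∀ a : FreeAlgebra ℂ X, mk deg rels a ∈
      Submodule.span ℂ (Set.range (GCAlg.word deg rels)) := by
    intro a
    induction a using FreeAlgebra.induction with
    | grade0 c =>
      rw [AlgHom.commutes, Algebra.algebraMap_eq_smul_one]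
      exact Submodule.smul_mem _ _ (Submodule.subset_span ⟨[], rfl⟩)
    | grade1 x => exact Submodule.subset_span ⟨[x], by simp⟩
    | mul a b ha hb =>
      rw [map_mul]
      refine Submodule.span_induction₂ (p := fun a b _ _ => a * b ∈
        Submodule.span ℂ (Set.range (GCAlg.word deg rels))) ?_ ?_ ?_ ?_ ?_ ?_ ?_ ha hb
      · rintro _ _ ⟨v, rfl⟩ ⟨w, rfl⟩
        exact Submodule.subset_span ⟨v ++ w, word_append v w⟩
      · intros; simp
      · intros; simp
      · intro a b c _ _ _ h h'; rw [add_mul]; exact add_mem h h'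
      · intro a b c _ _ _ h h'; rw [mul_add]; exact add_mem h h'
      · intro r a b _ _ h; rw [smul_mul_assoc]; exact Submodule.smul_mem _ _ h
      · intro r a b _ _ h; rw [mul_smul_comm]; exact Submodule.smul_mem _ _ h
    | add a b ha hb => rw [map_add]; exact add_mem ha hb
  obtain ⟨a, rfl⟩ := mk_surjective a
  generalize hb : mk deg rels a = b
  have hmem := hspan a
  rw [hb] at hmem
  clear hb
  induction hmem using Submodule.span_induction with
  | mem a h => obtain ⟨w, rfl⟩ := h; exact word w
  -- Zero needs no separate hypothesis: it is 0 times the empty word.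
  | zero => simpa using smul 0 _ (word [])
  | add a b _ _ h h' => exact add a b h h'
  | smul c a _ h => exact smul c a h

/-! #### Graded commutativity -/

lemma gen_mul_word (x : X) (w : List X) : gen deg rels x * word deg rels w
    = (-1 : ℂ) ^ (deg x * (w.map deg).sum) • (word deg rels w * gen deg rels x) := by
  induction w with
  | nil => simp
  | cons y w ih =>
    rw [word_cons, ← mul_assoc, gen_mul_gen, smul_mul_assoc, mul_assoc, ih, mul_smul_comm,
      smul_smul, ← pow_add, mul_assoc, List.map_cons, List.sum_cons, mul_add]

lemma word_mul_word (v w : List X) : word deg rels v * word deg rels w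
    = (-1 : ℂ) ^ ((v.map deg).sum * (w.map deg).sum) • (word deg rels w * word deg rels v) := by
  induction v with
  | nil => simp
  | cons y v ih =>
    rw [word_cons, mul_assoc, ih, mul_smul_comm, ← mul_assoc, gen_mul_word, smul_mul_assoc,
      smul_smul, ← pow_add, mul_assoc, List.map_cons, List.sum_cons, add_mul, add_comm]

lemma mul_comm_of_mem {p q : ℕ} {a b : GCAlg deg rels} (ha : a ∈ piece deg rels deg p)
    (hb : b ∈ piece deg rels deg q) : a * b = (-1 : ℂ) ^ (p * q) • (b * a) := by
  refine piece_induction (P := fun a => a * b = (-1 : ℂ) ^ (p * q) • (b * a))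
    (fun v hv => ?_) (by simp) (fun a a' h h' => ?_) (fun c a h => ?_) ha
  · refine piece_induction
      (P := fun b => word deg rels v * b = (-1 : ℂ) ^ (p * q) • (b * word deg rels v))
      (fun w hw => ?_) (by simp) (fun a a' h h' => ?_) (fun c a h => ?_) hb
    · rw [word_mul_word, hv, hw]
    · rw [mul_add, add_mul, smul_add, h, h']
    · rw [mul_smul_comm, smul_mul_assoc, h, smul_comm]
  · rw [mul_add, add_mul, smul_add, h, h']
  · rw [mul_smul_comm, smul_mul_assoc, h, smul_comm]

lemma neg_one_smul' (a : GCAlg deg rels) : (-1 : ℂ) • a = -a := by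
  have h : a + (-1 : ℂ) • a = 0 := by
    nth_rewrite 1 [← one_smul ℂ a]
    rw [← add_smul, add_neg_cancel, zero_smul]
  exact eq_neg_of_add_eq_zero_right h

/-- Graded commutativity gives a² = -a², and 2 is invertible in ℂ. -/
lemma mul_self_of_mem {a : GCAlg deg rels} (ha : a ∈ piece deg rels deg 1) : a * a = 0 := by
  have h := mul_comm_of_mem ha ha
  rw [mul_one, pow_one, neg_one_smul'] at h
  have h2 : (2 : ℂ) • (a * a) = 0 := by
    rw [two_smul]; nth_rewrite 1 [h]; exact neg_add_cancel _
  exact (smul_eq_zero.mp h2).resolve_left two_ne_zero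

lemma mul_anticomm_of_mem {a b : GCAlg deg rels} (ha : a ∈ piece deg rels deg 1)
    (hb : b ∈ piece deg rels deg 1) : a * b = -(b * a) := by
  have h := mul_comm_of_mem ha hb
  rwa [mul_one, pow_one, neg_one_smul'] at h

/-! #### Homogeneous relations -/

variable (deg) in
/-- The elements of degree `m` of the free algebra. -/
def freePiece (m : ℕ) : Submodule ℂ (FreeAlgebra ℂ X) :=
  Submodule.span ℂ {a | ∃ w : List X, (w.map deg).sum = m ∧ a = (w.map (FreeAlgebra.ι ℂ)).prod}

lemma one_mem_freePiece : (1 : FreeAlgebra ℂ X) ∈ freePiece deg 0 :=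
  Submodule.subset_span ⟨[], rfl, rfl⟩

lemma ι_mem_freePiece (x : X) : FreeAlgebra.ι ℂ x ∈ freePiece deg (deg x) :=
  Submodule.subset_span ⟨[x], by simp, by simp⟩

lemma ι_mul_ι_mem_freePiece (x y : X) :
    FreeAlgebra.ι ℂ x * FreeAlgebra.ι ℂ y ∈ freePiece deg (deg x + deg y) :=
  Submodule.subset_span ⟨[x, y], by simp, by simp⟩

lemma freePiece_induction {m : ℕ} {P : FreeAlgebra ℂ X → Prop}
    (word : ∀ w : List X, (w.map deg).sum = m → P (w.map (FreeAlgebra.ι ℂ)).prod) (zero : P 0)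
    (add : ∀ a b, P a → P b → P (a + b)) (smul : ∀ (c : ℂ) a, P a → P (c • a))
    {a : FreeAlgebra ℂ X} (ha : a ∈ freePiece deg m) : P a := by
  induction ha using Submodule.span_induction with
  | mem a h => obtain ⟨w, hw, rfl⟩ := h; exact word w hw
  | zero => exact zero
  | add a b _ _ h h' => exact add a b h h'
  | smul c a _ h => exact smul c a h

lemma mul_mem_freePiece {m m' : ℕ} {a b : FreeAlgebra ℂ X} (ha : a ∈ freePiece deg m)
    (hb : b ∈ freePiece deg m') : a * b ∈ freePiece deg (m + m') := by
  refine freePiece_induction (P := fun a => a * b ∈ freePiece deg (m + m'))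
    (fun w hw => ?_) (by simp) (fun a a' h h' => ?_) (fun c a h => ?_) ha
  · refine freePiece_induction
      (P := fun b => (w.map (FreeAlgebra.ι ℂ)).prod * b ∈ freePiece deg (m + m'))
      (fun w' hw' => ?_) (by simp) (fun a a' h h' => ?_) (fun c a h => ?_) hb
    · rw [← List.prod_append, ← List.map_append, ← hw, ← hw', ← List.sum_append,
        ← List.map_append]
      exact Submodule.subset_span ⟨_, rfl, rfl⟩
    · rw [mul_add]; exact add_mem h h'
    · rw [mul_smul_comm]; exact Submodule.smul_mem _ _ h
  · rw [add_mul]; exact add_mem h h'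
  · rw [smul_mul_assoc]; exact Submodule.smul_mem _ _ h

variable (deg rels) in
/-- All relations are homogeneous. -/
def HomogeneousRels : Prop := ∀ a ∈ rels, ∃ m, a ∈ freePiece deg m

/-- This makes `toPolynomial` well defined: a homogeneous relation goes to a single monomial whose
coefficient is its class, hence to zero. -/
lemma lift_monomial_of_mem {m : ℕ} {a : FreeAlgebra ℂ X} (ha : a ∈ freePiece deg m) :
    FreeAlgebra.lift ℂ (fun x => Polynomial.monomial (deg x) (gen deg rels x)) a
      = Polynomial.monomial m (mk deg rels a) := by
  refine freePiece_induction (P := fun a =>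
    FreeAlgebra.lift ℂ (fun x => Polynomial.monomial (deg x) (gen deg rels x)) a
      = Polynomial.monomial m (mk deg rels a)) (fun w hw => ?_) (by simp) (fun a a' h h' => ?_)
    (fun c a h => ?_) ha
  · subst hw
    clear ha
    induction w with
    | nil => simp
    | cons x w ih =>
      rw [List.map_cons, List.prod_cons, map_mul, ih, FreeAlgebra.lift_ι_apply,
        Polynomial.monomial_mul_monomial, map_mul (mk deg rels), mk_ι, List.map_cons, List.sum_cons]
  · rw [map_add, map_add, map_add, h, h']
  · rw [map_smul, map_smul, h, Polynomial.smul_monomial]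

/-- The homomorphism to the polynomial ring which multiplies elements of degree `m` by `X ^ m`. -/
def toPolynomial (hom : HomogeneousRels deg rels) :
    GCAlg deg rels →ₐ[ℂ] Polynomial (GCAlg deg rels) :=
  lift (fun x => Polynomial.monomial (deg x) (gen deg rels x))
    (fun x y => by
      rw [Polynomial.monomial_mul_monomial, Polynomial.monomial_mul_monomial,
        Polynomial.smul_monomial, gen_mul_gen, add_comm])
    (fun a ha => by
      obtain ⟨m, hm⟩ := hom a ha
      rw [lift_monomial_of_mem hm, mk_eq_zero ha, map_zero])

lemma toPolynomial_of_mem (hom : HomogeneousRels deg rels) {m : ℕ} {a : GCAlg deg rels}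
    (ha : a ∈ piece deg rels deg m) : toPolynomial hom a = Polynomial.monomial m a := by
  refine piece_induction (P := fun a => toPolynomial hom a = Polynomial.monomial m a)
    (fun w hw => ?_) (by simp) (fun a a' h h' => ?_) (fun c a h => ?_) ha
  · subst hw
    clear ha
    induction w with
    | nil => simp
    | cons x w ih =>
      rw [word_cons, map_mul, ih, toPolynomial, lift_gen,
        Polynomial.monomial_mul_monomial, List.map_cons, List.sum_cons]
  · rw [map_add, map_add, h, h']
  · rw [map_smul, h, Polynomial.smul_monomial]

/-- The coefficient of `X ^ m` under `toPolynomial` extracts the component of degree m, so a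
vanishing sum of homogeneous elements of distinct degrees vanishes term by term. Words span, which
gives exhaustion. -/
lemma isInternal_piece (hom : HomogeneousRels deg rels) :
    DirectSum.IsInternal (piece deg rels deg) := by
  classical
  rw [DirectSum.isInternal_submodule_iff_iSupIndep_and_iSup_eq_top,
    iSupIndep_iff_finsetSum_eq_zero_imp_eq_zero]
  constructor
  · intro s v hv hs m hm
    have h := congrArg (fun a => (toPolynomial hom a).coeff m) hs
    simp only [map_sum, map_zero, Polynomial.finsetSum_coeff, Polynomial.coeff_zero] at h
    rw [Finset.sum_eq_single m (fun k hk hkm => by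
      rw [toPolynomial_of_mem hom (hv k hk), Polynomial.coeff_monomial, if_neg hkm])
      (fun h => absurd hm h), toPolynomial_of_mem hom (hv m hm), Polynomial.coeff_monomial,
      if_pos rfl] at h
    exact h
  · rw [eq_top_iff]
    rintro a -
    exact word_induction (P := fun a => a ∈ ⨆ m, piece deg rels deg m)
      (fun w => Submodule.mem_iSup_of_mem _ (word_mem_piece w)) (fun _ _ => add_mem)
      (fun c _ => Submodule.smul_mem _ c) a

/-- Homogeneous lifts are needed because the sign in the Leibniz rule of `freeDer` depends on the
degree in the free algebra. -/
lemma exists_mem_freePiece {p : ℕ} {a : GCAlg deg rels} (ha : a ∈ piece deg rels deg p) :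
    ∃ b ∈ freePiece deg p, mk deg rels b = a := by
  refine piece_induction (P := fun a => ∃ b ∈ freePiece deg p, mk deg rels b = a)
    (fun w hw => ⟨_, Submodule.subset_span ⟨w, hw, rfl⟩, ?_⟩) ⟨0, zero_mem _, map_zero _⟩
    ?_ ?_ ha
  · rw [map_list_prod, List.map_map]; rfl
  · rintro _ _ ⟨a, ha, rfl⟩ ⟨b, hb, rfl⟩
    exact ⟨a + b, add_mem ha hb, map_add _ _ _⟩
  · rintro c _ ⟨a, ha, rfl⟩
    exact ⟨c • a, Submodule.smul_mem _ c ha, map_smul _ _ _⟩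

/-! #### Derivations of degree one -/

section Derivation

variable (δ : X → GCAlg deg rels)

/-- The homomorphism with value `(± x, δ x; 0, x)` on a generator `x`, where the sign is given by
the parity of the degree. -/
def derMatrix : FreeAlgebra ℂ X →ₐ[ℂ] Matrix (Fin 2) (Fin 2) (GCAlg deg rels) :=
  FreeAlgebra.lift ℂ
    (fun x => !![(-1 : ℂ) ^ deg x • gen deg rels x, δ x; 0, gen deg rels x])

/-- The derivation along the quotient map of the free algebra, with values `δ x` on generators. -/
def freeDer : FreeAlgebra ℂ X →ₗ[ℂ] GCAlg deg rels where
  toFun a := derMatrix δ a 0 1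
  map_add' a b := by rw [map_add]; rfl
  map_smul' c a := by rw [map_smul]; rfl

@[simp] lemma freeDer_ι (x : X) : freeDer δ (FreeAlgebra.ι ℂ x) = δ x := by
  change derMatrix δ (FreeAlgebra.ι ℂ x) 0 1 = δ x
  rw [derMatrix, FreeAlgebra.lift_ι_apply]; rfl

@[simp] lemma freeDer_one : freeDer δ 1 = 0 := by
  change derMatrix δ 1 0 1 = 0
  rw [map_one]; rfl

/-- The matrices are upper triangular with the quotient map in the lower corner. Multiplying such
matrices makes the upper right entry a twisted derivation, the twist being the sign automorphism in
the upper left. -/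
lemma derMatrix_row_one (a : FreeAlgebra ℂ X) :
    derMatrix δ a 1 0 = 0 ∧ derMatrix δ a 1 1 = mk deg rels a := by
  induction a using FreeAlgebra.induction with
  | grade0 c =>
    rw [AlgHom.commutes, AlgHom.commutes, Matrix.algebraMap_matrix_apply,
      Matrix.algebraMap_matrix_apply]
    simp
  | grade1 x => rw [derMatrix, FreeAlgebra.lift_ι_apply]; exact ⟨rfl, rfl⟩
  | mul a b ha hb =>
    rw [map_mul, map_mul, Matrix.mul_apply, Matrix.mul_apply, Fin.sum_univ_two, Fin.sum_univ_two,
      ha.1, ha.2, hb.1, hb.2]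
    simp
  | add a b ha hb =>
    rw [map_add, map_add, Matrix.add_apply, Matrix.add_apply, ha.1, ha.2, hb.1, hb.2]
    simp

lemma derMatrix_zero_zero {p : ℕ} {a : FreeAlgebra ℂ X} (ha : a ∈ freePiece deg p) :
    derMatrix δ a 0 0 = (-1 : ℂ) ^ p • mk deg rels a := by
  refine freePiece_induction
    (P := fun a => derMatrix δ a 0 0 = (-1 : ℂ) ^ p • mk deg rels a)
    (fun w hw => ?_) ?_ (fun a b h h' => ?_) (fun c a h => ?_) ha
  · subst hw
    clear ha
    induction w with
    | nil => simp
    | cons x w ih =>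
      rw [List.map_cons, List.prod_cons, map_mul, map_mul, Matrix.mul_apply, Fin.sum_univ_two,
        (derMatrix_row_one δ _).1, mul_zero, add_zero, ih, List.map_cons, List.sum_cons, pow_add,
        mk_ι, mul_smul, mul_smul_comm, smul_comm, ← smul_mul_assoc]
      have hx : derMatrix δ (FreeAlgebra.ι ℂ x) 0 0 = (-1 : ℂ) ^ deg x • gen deg rels x := by
        rw [derMatrix, FreeAlgebra.lift_ι_apply]; rfl
      rw [hx, smul_mul_assoc, smul_mul_assoc, smul_comm]
  · rw [map_zero, map_zero, smul_zero]; rfl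
  · rw [map_add, map_add, Matrix.add_apply, h, h', smul_add]
  · rw [map_smul, map_smul, Matrix.smul_apply, h, smul_comm]

lemma freeDer_mul {p : ℕ} {a : FreeAlgebra ℂ X} (ha : a ∈ freePiece deg p)
    (b : FreeAlgebra ℂ X) : freeDer δ (a * b)
      = freeDer δ a * mk deg rels b + (-1 : ℂ) ^ p • (mk deg rels a * freeDer δ b) := by
  change derMatrix δ (a * b) 0 1 = _
  rw [map_mul, Matrix.mul_apply, Fin.sum_univ_two, (derMatrix_row_one δ _).2,
    derMatrix_zero_zero δ ha, smul_mul_assoc, add_comm]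
  rfl

lemma freeDer_ι_mul_ι (x y : X) : freeDer δ (FreeAlgebra.ι ℂ x * FreeAlgebra.ι ℂ y)
    = δ x * gen deg rels y + (-1 : ℂ) ^ deg x • (gen deg rels x * δ y) := by
  rw [freeDer_mul δ (ι_mem_freePiece x), freeDer_ι, freeDer_ι, mk_ι, mk_ι]

variable {δ}

/-- The diagonal entries are multiples of the class of the relation, so only the upper right corner
imposes a condition. -/
lemma derMatrix_rel (hom : HomogeneousRels deg rels) (hrel : ∀ a ∈ rels, freeDer δ a = 0)
    {a : FreeAlgebra ℂ X} (ha : a ∈ rels) : derMatrix δ a = 0 := by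
  obtain ⟨m, hm⟩ := hom a ha
  ext i j
  fin_cases i <;> fin_cases j
  · change derMatrix δ a 0 0 = 0
    rw [derMatrix_zero_zero δ hm, mk_eq_zero ha, smul_zero]
  · exact hrel a ha
  · exact (derMatrix_row_one δ a).1
  · change derMatrix δ a 1 1 = 0
    rw [(derMatrix_row_one δ a).2, mk_eq_zero ha]

lemma freeDer_comm (hδ : ∀ x, δ x ∈ piece deg rels deg (deg x + 1)) (x y : X) :
    freeDer δ (FreeAlgebra.ι ℂ x * FreeAlgebra.ι ℂ y)
      = (-1 : ℂ) ^ (deg x * deg y) • freeDer δ (FreeAlgebra.ι ℂ y * FreeAlgebra.ι ℂ x) := by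
  rw [freeDer_ι_mul_ι, freeDer_ι_mul_ι, mul_comm_of_mem (hδ x) (gen_mem_piece y),
    mul_comm_of_mem (gen_mem_piece x) (hδ y), smul_add, smul_smul, smul_smul, ← pow_add,
    ← pow_add, add_comm]
  congr 2
  -- The exponents deg x + deg x (deg y + 1) and deg x deg y differ by the even number 2 deg x.
  · rw [mul_add, mul_one, ← add_assoc, add_comm (deg x), add_assoc, pow_add, ← two_mul, pow_mul]
    simp
  · rw [add_mul, one_mul]

/-- The derivation of degree one with values `δ x` on the generators. -/
lemma exists_derivation (hom : HomogeneousRels deg rels)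
    (hδ : ∀ x, δ x ∈ piece deg rels deg (deg x + 1)) (hrel : ∀ a ∈ rels, freeDer δ a = 0) :
    ∃ d : GCAlg deg rels →ₗ[ℂ] GCAlg deg rels, (∀ x, d (gen deg rels x) = δ x) ∧
      ∀ p, ∀ a ∈ piece deg rels deg p, ∀ b,
        d (a * b) = d a * b + (-1 : ℂ) ^ p • (a * d b) := by
  -- Descending the whole matrix homomorphism, rather than the derivation alone, lets the universal
  -- property of the quotient algebra apply.
  let D : GCAlg deg rels →ₐ[ℂ] Matrix (Fin 2) (Fin 2) (GCAlg deg rels) :=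
    RingQuot.liftAlgHom ℂ ⟨derMatrix δ, by
      intro a b h
      cases h with
      | rel a ha => rw [derMatrix_rel hom hrel ha, map_zero]
      | comm x y =>
        have hmk : mk deg rels (FreeAlgebra.ι ℂ x * FreeAlgebra.ι ℂ y) = mk deg rels
            ((-1 : ℂ) ^ (deg x * deg y) • (FreeAlgebra.ι ℂ y * FreeAlgebra.ι ℂ x)) := by
          rw [map_smul, map_mul, map_mul, mk_ι, mk_ι, gen_mul_gen]
        ext i j
        fin_cases i <;> fin_cases j
        · change derMatrix δ _ 0 0 = derMatrix δ _ 0 0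
          rw [derMatrix_zero_zero δ (ι_mul_ι_mem_freePiece x y), derMatrix_zero_zero δ
            (Submodule.smul_mem _ _ (ι_mul_ι_mem_freePiece y x)), hmk, add_comm]
        · change freeDer δ _ = freeDer δ _
          rw [map_smul, freeDer_comm hδ]
        · change derMatrix δ _ 1 0 = derMatrix δ _ 1 0
          rw [(derMatrix_row_one δ _).1, (derMatrix_row_one δ _).1]
        · change derMatrix δ _ 1 1 = derMatrix δ _ 1 1
          rw [(derMatrix_row_one δ _).2, (derMatrix_row_one δ _).2, hmk]⟩
  let d : GCAlg deg rels →ₗ[ℂ] GCAlg deg rels :=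
    { toFun := fun a => D a 0 1
      map_add' := fun a b => by rw [map_add]; rfl
      map_smul' := fun c a => by rw [map_smul]; rfl }
  have hd : ∀ a, d (mk deg rels a) = freeDer δ a := fun a =>
    congrArg (fun M => M 0 1) (RingQuot.liftAlgHom_mkAlgHom_apply ℂ (derMatrix δ) _ a)
  refine ⟨d, fun x => by rw [← mk_ι, hd, freeDer_ι], fun p a ha b => ?_⟩
  obtain ⟨a, ha', rfl⟩ := exists_mem_freePiece ha
  obtain ⟨b, rfl⟩ := mk_surjective b
  rw [← map_mul, hd, hd, hd, freeDer_mul δ ha']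

end Derivation

section CDGA

variable {d : GCAlg deg rels →ₗ[ℂ] GCAlg deg rels}

lemma derivation_one (hd : ∀ p, ∀ a ∈ piece deg rels deg p, ∀ b,
    d (a * b) = d a * b + (-1 : ℂ) ^ p • (a * d b)) : d 1 = 0 := by
  have h := hd 0 1 one_mem_piece 1
  simpa using h

lemma derivation_gen_mul (hd : ∀ p, ∀ a ∈ piece deg rels deg p, ∀ b,
    d (a * b) = d a * b + (-1 : ℂ) ^ p • (a * d b)) (x : X) (b : GCAlg deg rels) :
    d (gen deg rels x * b)
      = d (gen deg rels x) * b + (-1 : ℂ) ^ deg x • (gen deg rels x * d b) :=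
  hd _ _ (gen_mem_piece x) b

lemma derivation_ext {d' : GCAlg deg rels →ₗ[ℂ] GCAlg deg rels}
    (hd : ∀ p, ∀ a ∈ piece deg rels deg p, ∀ b,
      d (a * b) = d a * b + (-1 : ℂ) ^ p • (a * d b))
    (hd' : ∀ p, ∀ a ∈ piece deg rels deg p, ∀ b,
      d' (a * b) = d' a * b + (-1 : ℂ) ^ p • (a * d' b))
    (h : ∀ x, d (gen deg rels x) = d' (gen deg rels x)) : d = d' := by
  ext a
  refine word_induction (P := fun a => d a = d' a) (fun w => ?_)
    (fun a b ha hb => by rw [map_add, map_add, ha, hb])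
    (fun c a ha => by rw [map_smul, map_smul, ha]) a
  induction w with
  | nil => rw [word_nil, derivation_one hd, derivation_one hd']
  | cons x w ih =>
    rw [word_cons, derivation_gen_mul hd, derivation_gen_mul hd', h, ih]

lemma isCDGA_of_derivation (hom : HomogeneousRels deg rels)
    (hd : ∀ p, ∀ a ∈ piece deg rels deg p, ∀ b,
      d (a * b) = d a * b + (-1 : ℂ) ^ p • (a * d b))
    (hdeg : ∀ x, d (gen deg rels x) ∈ piece deg rels deg (deg x + 1))
    (hdd : ∀ x, d (d (gen deg rels x)) = 0) : IsCDGA (piece deg rels deg) d where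
  gradedMonoid := gradedMonoid_piece
  isInternal := isInternal_piece hom
  comm p q a ha b hb := mul_comm_of_mem ha hb
  map_deg p a ha := by
    refine piece_induction (P := fun a => d a ∈ piece deg rels deg (p + 1)) (fun w hw => ?_)
      (by rw [map_zero]; exact zero_mem _)
      (fun a b h h' => by rw [map_add]; exact add_mem h h')
      (fun c a h => by rw [map_smul]; exact Submodule.smul_mem _ c h) ha
    clear ha
    subst hw
    induction w with
    | nil => rw [word_nil, derivation_one hd]; exact zero_mem _
    | cons x w ih =>
      rw [word_cons, derivation_gen_mul hd, List.map_cons, List.sum_cons]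
      refine add_mem ?_ (Submodule.smul_mem _ _ ?_)
      · rw [add_right_comm]; exact mul_mem_piece (hdeg x) (word_mem_piece w)
      · rw [add_assoc]; exact mul_mem_piece (gen_mem_piece x) ih
  leibniz := hd
  d_d a := by
    refine word_induction (P := fun a => d (d a) = 0) (fun w => ?_)
      (fun a b h h' => by rw [map_add, map_add, h, h', add_zero])
      (fun c a h => by rw [map_smul, map_smul, h, smul_zero]) a
    induction w with
    | nil => rw [word_nil, derivation_one hd, map_zero]
    | cons x w ih =>
      -- The two cross terms, both equal to dx · dw up to sign, cancel because dx has degree deg x +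
      -- 1.
      rw [word_cons, derivation_gen_mul hd, map_add, map_smul, hd _ _ (hdeg x),
        derivation_gen_mul hd, hdd, ih, zero_mul, mul_zero, smul_zero, zero_add, add_zero,
        pow_succ, mul_smul, neg_one_smul', smul_neg, neg_add_cancel]

end CDGA

/-- Both composites of f with the differentials are derivations along f, hence determined by their
values on generators. -/
lemma isDGMorphism_of_gen {Y : Type} {deg' : Y → ℕ} {rels' : Set (FreeAlgebra ℂ Y)}
    {d : GCAlg deg rels →ₗ[ℂ] GCAlg deg rels} {d' : GCAlg deg' rels' →ₗ[ℂ] GCAlg deg' rels'}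
    (hd : IsCDGA (piece deg rels deg) d) (hd' : IsCDGA (piece deg' rels' deg') d')
    {f : GCAlg deg rels →ₐ[ℂ] GCAlg deg' rels'}
    (hdeg : ∀ x, f (gen deg rels x) ∈ piece deg' rels' deg' (deg x))
    (hf : ∀ x, f (d (gen deg rels x)) = d' (f (gen deg rels x))) :
    IsDGMorphism (piece deg rels deg) d (piece deg' rels' deg') d' f where
  map_deg p a ha := by
    refine piece_induction (P := fun a => f a ∈ piece deg' rels' deg' p) (fun w hw => ?_)
      (by rw [map_zero]; exact zero_mem _)
      (fun a b h h' => by rw [map_add]; exact add_mem h h')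
      (fun c a h => by rw [map_smul]; exact Submodule.smul_mem _ c h) ha
    clear ha
    subst hw
    induction w with
    | nil => rw [word_nil, map_one]; exact one_mem_piece
    | cons x w ih =>
      rw [word_cons, map_mul, List.map_cons, List.sum_cons]
      exact mul_mem_piece (hdeg x) ih
  comm_d a := by
    refine word_induction (P := fun a => f (d a) = d' (f a)) (fun w => ?_)
      (fun a b h h' => by rw [map_add, map_add, map_add, map_add, h, h'])
      (fun c a h => by rw [map_smul, map_smul, map_smul, map_smul, h]) a
    induction w with
    | nil =>
      rw [word_nil, derivation_one hd.leibniz, map_one, map_zero, derivation_one hd'.leibniz]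
    | cons x w ih =>
      rw [word_cons, derivation_gen_mul hd.leibniz, map_add, map_smul, map_mul, map_mul, map_mul,
        hd'.leibniz _ _ (hdeg x), hf, ih]

end GCAlg

/-! ### Power series in α and β -/

section Series

open MvPowerSeries

variable {R : Type} [Ring R]

/-- The sequence `0, c w_0, c w_1, …`. -/
def shift (c : R) (w : ℕ → R) : ℕ → R
  | 0 => 0
  | m + 1 => c * w m

lemma coeff_X_mul_eq (s : Fin 2) (f : MvPowerSeries (Fin 2) R) (e : Fin 2 →₀ ℕ) :
    coeff e (X s * f) = if e s = 0 then 0 else coeff (e - Finsupp.single s 1) f := by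
  classical
  rw [X, coeff_monomial_mul, one_mul]
  by_cases h : e s = 0
  · rw [if_pos h, if_neg]
    intro h'
    have := h' s
    simp [h] at this
  · rw [if_neg h, if_pos]
    rw [Finsupp.single_le_iff]; omega

lemma coeff_serA (w : ℕ → R) (e : Fin 2 →₀ ℕ) :
    coeff e (serA w) = if e 1 = 0 then w (e 0) else 0 := rfl

lemma coeff_serB (w : ℕ → R) (e : Fin 2 →₀ ℕ) :
    coeff e (serB w) = if e 0 = 0 then w (e 1) else 0 := rfl

lemma coeff_serAB (w : ℕ → R) (e : Fin 2 →₀ ℕ) :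
    coeff e (serAB w) = (e 0 + e 1).choose (e 0) • w (e 0 + e 1) := rfl

lemma serA_shift (c : R) (w : ℕ → R) : serA (shift c w) = X 0 * (C c * serA w) := by
  ext e
  rw [coeff_X_mul_eq, coeff_C_mul, coeff_serA, coeff_serA]
  rcases h : e 0 with _ | m <;> simp [shift, h]

lemma serB_shift (c : R) (w : ℕ → R) : serB (shift c w) = X 1 * (C c * serB w) := by
  ext e
  rw [coeff_X_mul_eq, coeff_C_mul, coeff_serB, coeff_serB]
  rcases h : e 1 with _ | m <;> simp [shift, h]

/-- Coefficientwise this is Pascal's rule for the binomial coefficients of (α + β)^m. -/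
lemma serAB_shift (c : R) (w : ℕ → R) :
    serAB (shift c w) = (X 0 + X 1) * (C c * serAB w) := by
  ext e
  rw [add_mul, map_add, coeff_X_mul_eq, coeff_X_mul_eq, coeff_C_mul, coeff_C_mul, coeff_serAB,
    coeff_serAB, coeff_serAB]
  rcases h : e 0 with _ | k <;> rcases h' : e 1 with _ | m
  · simp [shift]
  · simp [shift, h, h']
  · simp [shift, h, h']
  · simp only [Finsupp.coe_tsub, Pi.sub_apply, Finsupp.single_eq_same, h, h', Nat.add_sub_cancel,
      Nat.succ_ne_zero, if_false]
    rw [Finsupp.single_eq_of_ne (by decide), Finsupp.single_eq_of_ne (by decide), Nat.sub_zero,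
      Nat.sub_zero, show k + 1 + (m + 1) = (k + m + 1) + 1 by ring,
      show k + (m + 1) = k + m + 1 by ring, show k + 1 + m = k + m + 1 by ring,
      Nat.choose_succ_succ, shift, mul_smul_comm, mul_smul_comm, ← add_smul]

lemma map_serA {S : Type} [Ring S] (f : R →+* S) (w : ℕ → R) :
    MvPowerSeries.map f (serA w) = serA fun m => f (w m) := by
  ext e
  rw [coeff_map, coeff_serA, coeff_serA, apply_ite f, map_zero f]

lemma map_serB {S : Type} [Ring S] (f : R →+* S) (w : ℕ → R) :
    MvPowerSeries.map f (serB w) = serB fun m => f (w m) := by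
  ext e
  rw [coeff_map, coeff_serB, coeff_serB, apply_ite f, map_zero f]

lemma map_serAB {S : Type} [Ring S] (f : R →+* S) (w : ℕ → R) :
    MvPowerSeries.map f (serAB w) = serAB fun m => f (w m) := by
  ext e
  rw [coeff_map, coeff_serAB, coeff_serAB, map_nsmul]

end Series

section Fay

open MvPowerSeries

variable {n : ℕ}

/-- Used twice: for the quotient map to Ξ_n, and for the homomorphism to E_2(n) underlying ψ. -/
lemma map_fay {S : Type} [Ring S] (f : FreeAlgebra ℂ (XiGen n) →+* S)
    {w : Fin n → Fin n → ℕ → S} (hw : ∀ i j m, f (XiGen.seq i j m) = w i j m) (i j l : Fin n) :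
    MvPowerSeries.map f (fay i j l) = (X 0 + X 1) * (serA (w i l) * serB (w j l))
      + X 0 * (serB (w j i) * serAB (w i l)) + X 1 * (serAB (w j l) * serA (w i j)) := by
  simp only [fay, map_add, map_mul, map_serA, map_serB, map_serAB, MvPowerSeries.map_X, hw]

end Fay

/-! ### The differential of Ξ_n -/

namespace Xi

open GCAlg MvPowerSeries

variable {n : ℕ}

lemma omm_symm (i j : Fin n) (m : ℕ) : omm i j m + (-1 : ℂ) ^ m • omm j i m = 0 := by
  have h := mk_eq_zero (deg := XiGen.deg) (rels := {a | XiRel n a}) (XiRel.symm i j m)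
  rwa [map_add, map_smul] at h

lemma omm_zero (i j : Fin n) : omm i j 0 = om i - om j := by
  have h := mk_eq_zero (deg := XiGen.deg) (rels := {a | XiRel n a}) (XiRel.zero i j)
  rw [map_sub, map_sub] at h
  exact sub_eq_zero.mp h

/-! #### Homogeneity of the relations -/

lemma coeff_mul_mem_freePiece {f g : MvPowerSeries (Fin 2) (FreeAlgebra ℂ (XiGen n))} {p q : ℕ}
    (hf : ∀ e, coeff e f ∈ freePiece XiGen.deg p) (hg : ∀ e, coeff e g ∈ freePiece XiGen.deg q)
    (e : Fin 2 →₀ ℕ) : coeff e (f * g) ∈ freePiece XiGen.deg (p + q) := by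
  classical
  rw [coeff_mul]
  exact sum_mem fun x _ => mul_mem_freePiece (hf _) (hg _)

lemma coeff_X_mul_mem_freePiece {f : MvPowerSeries (Fin 2) (FreeAlgebra ℂ (XiGen n))} {p : ℕ}
    (hf : ∀ e, coeff e f ∈ freePiece XiGen.deg p) (s : Fin 2) (e : Fin 2 →₀ ℕ) :
    coeff e (X s * f) ∈ freePiece XiGen.deg p := by
  classical
  rw [coeff_mul]
  refine sum_mem fun x _ => ?_
  rw [coeff_X]
  split_ifs
  · rw [one_mul]; exact hf _
  · rw [zero_mul]; exact zero_mem _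

lemma coeff_serA_mem (i j : Fin n) (e : Fin 2 →₀ ℕ) :
    coeff e (serA (XiGen.seq i j)) ∈ freePiece XiGen.deg 1 := by
  change (if e 1 = 0 then XiGen.seq i j (e 0) else 0) ∈ _
  split_ifs
  · exact ι_mem_freePiece _
  · exact zero_mem _

lemma coeff_serB_mem (i j : Fin n) (e : Fin 2 →₀ ℕ) :
    coeff e (serB (XiGen.seq i j)) ∈ freePiece XiGen.deg 1 := by
  change (if e 0 = 0 then XiGen.seq i j (e 1) else 0) ∈ _
  split_ifs
  · exact ι_mem_freePiece _
  · exact zero_mem _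

lemma coeff_serAB_mem (i j : Fin n) (e : Fin 2 →₀ ℕ) :
    coeff e (serAB (XiGen.seq i j)) ∈ freePiece XiGen.deg 1 := by
  change (e 0 + e 1).choose (e 0) • XiGen.seq i j (e 0 + e 1) ∈ _
  exact nsmul_mem (ι_mem_freePiece (deg := XiGen.deg) (XiGen.omm i j _)) _

lemma homogeneousRels : HomogeneousRels XiGen.deg {a | XiRel n a} := by
  rintro _ (⟨i, j, m⟩ | ⟨i, j⟩ | ⟨i, j, l, e⟩)
  · exact ⟨1, add_mem (ι_mem_freePiece _)
      (Submodule.smul_mem _ _ (ι_mem_freePiece (deg := XiGen.deg) _))⟩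
  · exact ⟨1, sub_mem (ι_mem_freePiece _)
      (sub_mem (ι_mem_freePiece (deg := XiGen.deg) _) (ι_mem_freePiece (deg := XiGen.deg) _))⟩
  · refine ⟨2, ?_⟩
    have h1 := coeff_mul_mem_freePiece (coeff_serA_mem i l) (coeff_serB_mem j l)
    have h2 := coeff_mul_mem_freePiece (coeff_serB_mem j i) (coeff_serAB_mem i l)
    have h3 := coeff_mul_mem_freePiece (coeff_serAB_mem j l) (coeff_serA_mem i j)
    rw [fay, add_mul, map_add, map_add, map_add]
    exact add_mem (add_mem (add_mem (coeff_X_mul_mem_freePiece h1 0 e)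
      (coeff_X_mul_mem_freePiece h1 1 e)) (coeff_X_mul_mem_freePiece h2 0 e))
      (coeff_X_mul_mem_freePiece h3 1 e)

/-! #### The differential -/

/-- The values of the differential on the generators. -/
def dGen : XiGen n → Xi n
  | .om _ => 0
  | .nu _ => 0
  | .omm _ _ 0 => 0
  | .omm i j (m + 1) => (nu i - nu j) * omm i j m

lemma dGen_mem (x : XiGen n) : dGen x ∈ piece XiGen.deg {a | XiRel n a} XiGen.deg 2 := by
  match x with
  | .om _ => exact zero_mem _
  | .nu _ => exact zero_mem _
  | .omm _ _ 0 => exact zero_mem _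
  | .omm i j (m + 1) =>
    exact mul_mem_piece (m := 1) (m' := 1)
      (sub_mem (gen_mem_piece (XiGen.nu i)) (gen_mem_piece (deg' := XiGen.deg) (XiGen.nu j)))
      (gen_mem_piece (XiGen.omm i j m))

/-- The derivation applied to all coefficients of a power series. -/
def serD (f : MvPowerSeries (Fin 2) (FreeAlgebra ℂ (XiGen n))) : MvPowerSeries (Fin 2) (Xi n) :=
  fun e => freeDer dGen (coeff e f)

/-- The quotient map applied to all coefficients of a power series. -/
def serMk : MvPowerSeries (Fin 2) (FreeAlgebra ℂ (XiGen n)) →+* MvPowerSeries (Fin 2) (Xi n) :=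
  MvPowerSeries.map (mk XiGen.deg {a | XiRel n a}).toRingHom

lemma coeff_serD (e : Fin 2 →₀ ℕ) (f : MvPowerSeries (Fin 2) (FreeAlgebra ℂ (XiGen n))) :
    coeff e (serD f) = freeDer dGen (coeff e f) := rfl

lemma serD_add (f g : MvPowerSeries (Fin 2) (FreeAlgebra ℂ (XiGen n))) :
    serD (f + g) = serD f + serD g := by
  ext e
  rw [coeff_serD, map_add, map_add, map_add]; rfl

lemma serD_X_mul (s : Fin 2) (f : MvPowerSeries (Fin 2) (FreeAlgebra ℂ (XiGen n))) :
    serD (X s * f) = X s * serD f := by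
  classical
  ext e
  rw [coeff_serD, coeff_mul, coeff_mul, map_sum]
  refine Finset.sum_congr rfl fun x _ => ?_
  rw [coeff_X, coeff_X, coeff_serD]
  split_ifs
  · rw [one_mul, one_mul]
  · rw [zero_mul, zero_mul, map_zero]

/-- Leibniz rule in each coefficient; the minus sign is there because all coefficients of f are odd.
-/
lemma serD_mul {f : MvPowerSeries (Fin 2) (FreeAlgebra ℂ (XiGen n))}
    (hf : ∀ e, coeff e f ∈ freePiece XiGen.deg 1)
    (g : MvPowerSeries (Fin 2) (FreeAlgebra ℂ (XiGen n))) :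
    serD (f * g) = serD f * serMk g - serMk f * serD g := by
  classical
  ext e
  rw [coeff_serD, map_sub, coeff_mul, coeff_mul, coeff_mul, map_sum, ← Finset.sum_sub_distrib]
  refine Finset.sum_congr rfl fun x _ => ?_
  rw [freeDer_mul _ (hf _), pow_one, neg_one_smul', ← sub_eq_add_neg]
  rfl

lemma serMk_serA (i j : Fin n) : serMk (serA (XiGen.seq i j)) = serA (omm i j) :=
  map_serA _ _

lemma serMk_serB (i j : Fin n) : serMk (serB (XiGen.seq i j)) = serB (omm i j) :=
  map_serB _ _

lemma serMk_serAB (i j : Fin n) : serMk (serAB (XiGen.seq i j)) = serAB (omm i j) :=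
  map_serAB _ _

lemma dGen_omm (i j : Fin n) (m : ℕ) :
    dGen (XiGen.omm i j m) = shift (nu i - nu j) (omm i j) m := by
  cases m <;> rfl

/-- The rule for dω_ij^{(m+1)}, with dω_ij^{(0)} = 0, says that d multiplies the series by α(ν_i -
ν_j). The next two lemmas are the same with β and α + β. -/
lemma serD_serA (i j : Fin n) :
    serD (serA (XiGen.seq i j)) = X 0 * (C (nu i - nu j) * serA (omm i j)) := by
  rw [← serA_shift]
  ext e
  rw [coeff_serD, coeff_serA, coeff_serA, ← dGen_omm]
  split_ifs
  · exact freeDer_ι _ _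
  · exact map_zero _

lemma serD_serB (i j : Fin n) :
    serD (serB (XiGen.seq i j)) = X 1 * (C (nu i - nu j) * serB (omm i j)) := by
  rw [← serB_shift]
  ext e
  rw [coeff_serD, coeff_serB, coeff_serB, ← dGen_omm]
  split_ifs
  · exact freeDer_ι _ _
  · exact map_zero _

lemma serD_serAB (i j : Fin n) :
    serD (serAB (XiGen.seq i j)) = (X 0 + X 1) * (C (nu i - nu j) * serAB (omm i j)) := by
  rw [← serAB_shift]
  ext e
  rw [coeff_serD, coeff_serAB, coeff_serAB, ← dGen_omm, map_nsmul]
  exact congrArg _ (freeDer_ι _ _)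

lemma omm_mul_nu (i j k l : Fin n) (m : ℕ) :
    omm i j m * (nu k - nu l) = -((nu k - nu l) * omm i j m) :=
  mul_anticomm_of_mem (gen_mem_piece (XiGen.omm i j m))
    (sub_mem (gen_mem_piece (XiGen.nu k)) (gen_mem_piece (deg' := XiGen.deg) (XiGen.nu l)))

lemma serA_mul_C (i j k l : Fin n) :
    serA (omm i j) * C (nu k - nu l) = -(C (nu k - nu l) * serA (omm i j)) := by
  ext e
  rw [coeff_mul_C, map_neg, coeff_C_mul, coeff_serA]
  split_ifs
  · exact omm_mul_nu _ _ _ _ _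
  · rw [zero_mul, mul_zero, neg_zero]

lemma serB_mul_C (i j k l : Fin n) :
    serB (omm i j) * C (nu k - nu l) = -(C (nu k - nu l) * serB (omm i j)) := by
  ext e
  rw [coeff_mul_C, map_neg, coeff_C_mul, coeff_serB]
  split_ifs
  · exact omm_mul_nu _ _ _ _ _
  · rw [zero_mul, mul_zero, neg_zero]

lemma serAB_mul_C (i j k l : Fin n) :
    serAB (omm i j) * C (nu k - nu l) = -(C (nu k - nu l) * serAB (omm i j)) := by
  ext e
  rw [coeff_mul_C, map_neg, coeff_C_mul, coeff_serAB, smul_mul_assoc, omm_mul_nu, mul_smul_comm,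
    smul_neg]

lemma fay_eq_zero (i j l : Fin n) :
    (X 0 + X 1) * (serA (omm i l) * serB (omm j l)) + X 0 * (serB (omm j i) * serAB (omm i l))
      + X 1 * (serAB (omm j l) * serA (omm i j)) = 0 := by
  have h : serMk (fay i j l) = 0 := by
    ext e
    exact mk_eq_zero (deg := XiGen.deg) (rels := {a | XiRel n a}) (XiRel.fay i j l e)
  exact (map_fay _ (fun _ _ _ => rfl) i j l).symm.trans h

/-- The Leibniz rule for elements of degree one with logarithmic derivatives `x * c` and
`y * c'`, where `y` is central. -/
lemma leibniz_log {S : Type} [Ring S] {x y a b c c' : S}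
    (hy : ∀ s, Commute y s) (hac : a * c' = -(c' * a)) :
    x * (c * a) * b - a * (y * (c' * b)) = (x * c + y * c') * (a * b) := by
  have h : a * (y * (c' * b)) = -(y * c' * (a * b)) := by
    rw [← mul_assoc a y, ← (hy a).eq, mul_assoc, ← mul_assoc a c', hac]
    noncomm_ring
  rw [h]
  noncomm_ring

/-- With x = α, y = β and a, b, c = ν_i, ν_j, ν_l, the left side is the logarithmic derivative of
the second Fay product and the right side that of the first. `telescope₂` treats the third product.
-/
lemma telescope₁ {S : Type} [Ring S] (x y a b c : S) :
    y * (b - a) + (x + y) * (a - c) = x * (a - c) + y * (b - c) := by noncomm_ring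

lemma telescope₂ {S : Type} [Ring S] (x y a b c : S) :
    (x + y) * (b - c) + x * (a - b) = x * (a - c) + y * (b - c) := by noncomm_ring

lemma mul_central_sum {S : Type} [Ring S] {x y z k : S} (hx : Commute x k) (hy : Commute y k)
    (hz : Commute z k) (a b c : S) :
    x * (k * a) + y * (k * b) + z * (k * c) = k * (x * a + y * b + z * c) := by
  rw [← mul_assoc, ← mul_assoc, ← mul_assoc, hx.eq, hy.eq, hz.eq]
  noncomm_ring

/-- The three products share one logarithmic derivative, so differentiating the relation multiplies
its image in Ξ_n by that factor. -/
lemma serD_fay (i j l : Fin n) : serD (fay i j l) = 0 := by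
  have hX : ∀ s (f : MvPowerSeries (Fin 2) (Xi n)), Commute (X s) f :=
    fun s f => (commute_X f s).symm
  have hXX : ∀ f : MvPowerSeries (Fin 2) (Xi n), Commute (X 0 + X 1) f :=
    fun f => (hX 0 f).add_left (hX 1 f)
  have key : serD (fay i j l)
      = (X 0 * C (nu i - nu l) + X 1 * C (nu j - nu l)) *
        ((X 0 + X 1) * (serA (omm i l) * serB (omm j l))
          + X 0 * (serB (omm j i) * serAB (omm i l))
          + X 1 * (serAB (omm j l) * serA (omm i j))) := by
    have h2 : X 1 * C (nu j - nu i) + (X 0 + X 1) * C (nu i - nu l)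
        = (X 0 * C (nu i - nu l) + X 1 * C (nu j - nu l) : MvPowerSeries (Fin 2) (Xi n)) := by
      rw [map_sub, map_sub, map_sub]
      exact telescope₁ _ _ _ _ _
    have h3 : (X 0 + X 1) * C (nu j - nu l) + X 0 * C (nu i - nu j)
        = (X 0 * C (nu i - nu l) + X 1 * C (nu j - nu l) : MvPowerSeries (Fin 2) (Xi n)) := by
      rw [map_sub, map_sub, map_sub]
      exact telescope₂ _ _ _ _ _
    rw [fay, add_mul, serD_add, serD_add, serD_add, serD_X_mul, serD_X_mul, serD_X_mul,
      serD_X_mul, ← add_mul, serD_mul (coeff_serA_mem i l), serD_mul (coeff_serB_mem j i),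
      serD_mul (coeff_serAB_mem j l), serMk_serA, serMk_serA, serMk_serB, serMk_serB,
      serMk_serAB, serMk_serAB, serD_serA, serD_serA, serD_serB, serD_serB, serD_serAB,
      serD_serAB, leibniz_log (hX 1) (serA_mul_C _ _ _ _),
      leibniz_log hXX (serB_mul_C _ _ _ _), leibniz_log (hX 0) (serAB_mul_C _ _ _ _),
      h2, h3]
    exact mul_central_sum (hXX _) (hX 0 _) (hX 1 _) _ _ _
  rw [key, fay_eq_zero, mul_zero]

lemma neg_sub_mul {S : Type} [Ring S] (a b c : S) : -((b - a) * c) = (a - b) * c := by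
  rw [← neg_mul, neg_sub]

lemma freeDer_rel (a : FreeAlgebra ℂ (XiGen n)) (ha : XiRel n a) :
    freeDer (dGen (n := n)) a = 0 := by
  cases ha with
  | symm i j m =>
    rw [map_add, map_smul, freeDer_ι, freeDer_ι]
    cases m with
    | zero => simp [dGen]
    | succ m =>
      -- Differentiating the symmetry relation of order m + 1 gives ν_i - ν_j times the one of order
      -- m; the extra sign is absorbed by ν_j - ν_i.
      have h := congrArg (fun a => (nu i - nu j) * a) (omm_symm i j m)
      simp only [mul_add, mul_smul_comm, mul_zero] at h
      rw [dGen, dGen, pow_succ, mul_smul, neg_one_smul', ← h]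
      congr 2
      exact neg_sub_mul _ _ _
  | zero i j => simp [dGen]
  | fay i j l e => exact congrArg (coeff e) (serD_fay i j l)

/-- The value on ω_ij^{(0)}, which is not prescribed, is forced by ω_ij^{(0)} = ω_i - ω_j. -/
lemma derivation_values {d : Xi n →ₗ[ℂ] Xi n} (hd : IsDifferential n d) (x : XiGen n) :
    d (gen _ _ x) = dGen x := by
  match x with
  | .om i => exact hd.d_om i
  | .nu i => exact hd.d_nu i
  | .omm i j 0 =>
    change d (omm i j 0) = 0
    rw [omm_zero, map_sub, hd.d_om, hd.d_om, sub_zero]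
  | .omm i j (m + 1) => exact hd.d_omm i j m

lemma existsUnique_differential : ∃! d : Xi n →ₗ[ℂ] Xi n, IsDifferential n d := by
  obtain ⟨d, hgen, hd⟩ := exists_derivation homogeneousRels dGen_mem (freeDer_rel (n := n))
  refine ⟨d, ⟨isCDGA_of_derivation homogeneousRels hd
    (fun x => by rw [hgen]; exact dGen_mem x) (fun x => ?_), fun i => hgen (XiGen.om i),
    fun i => hgen (XiGen.nu i), fun i j m => hgen (XiGen.omm i j (m + 1))⟩,
    fun d' hd' => derivation_ext hd'.isCDGA.leibniz hd
      fun x => by rw [derivation_values hd', hgen]⟩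
  rw [hgen]
  match x with
  | .om i => exact map_zero d
  | .nu i => exact map_zero d
  | .omm i j 0 => exact map_zero d
  | .omm i j (m + 1) =>
    have hnu : ∀ i : Fin n, d (nu i) = 0 := fun i => hgen (XiGen.nu i)
    have homm : d (omm i j m) = dGen (XiGen.omm i j m) := hgen (XiGen.omm i j m)
    have hmem : nu i - nu j ∈ piece XiGen.deg {a | XiRel n a} XiGen.deg 1 :=
      sub_mem (gen_mem_piece (XiGen.nu i)) (gen_mem_piece (deg' := XiGen.deg) (XiGen.nu j))
    rw [dGen, hd 1 _ hmem, map_sub, hnu, hnu, sub_zero, zero_mul, zero_add, homm]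
    cases m with
    | zero => rw [dGen, mul_zero, smul_zero]
    -- Applying d twice produces (ν_i - ν_j)², the square of an odd element.
    | succ m => rw [dGen, ← mul_assoc, mul_self_of_mem hmem, zero_mul, smul_zero]

end Xi

/-! ### Functions on the affine curve and the derivation ∂_x -/

section CoordRing

open Polynomial

variable (τ : ℍ)

/-- The function `v = ℘'(x)`. -/
def wp' : CoordRing τ := CoordRing.mk τ (MvPolynomial.X 1)

lemma wp'_sq : wp' τ ^ 2 = 4 * wp τ ^ 3 - algebraMap ℂ _ (periods τ).g₂ * wp τ
    - algebraMap ℂ _ (periods τ).g₃ := by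
  have h : CoordRing.mk τ (curveEqn τ) = 0 :=
    Ideal.Quotient.eq_zero_iff_mem.mpr (Ideal.subset_span rfl)
  rw [curveEqn] at h
  simp only [map_sub, map_pow, map_mul, map_ofNat, ← MvPolynomial.algebraMap_eq,
    AlgHom.commutes] at h
  exact sub_eq_zero.mp h

lemma der_mk (a : MvPolynomial (Fin 2) ℂ) :
    der τ (CoordRing.mk τ a) = CoordRing.mk τ (polyDer τ a) :=
  Derivation.liftOfSurjective_apply (Ideal.Quotient.mkₐ_surjective ℂ _)
    (fun b hb => Ideal.Quotient.eq_zero_iff_mem.mpr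
      (polyDer_mem τ b (Ideal.Quotient.eq_zero_iff_mem.mp hb))) a

lemma der_wp : der τ (wp τ) = wp' τ := by
  rw [wp, der_mk, polyDer, MvPolynomial.mkDerivation_X]; rfl

lemma der_wp' : der τ (wp' τ) = 6 * wp τ ^ 2 - algebraMap ℂ _ ((periods τ).g₂ / 2) := by
  rw [wp', der_mk, polyDer, MvPolynomial.mkDerivation_X]
  simp only [Matrix.cons_val_one, Matrix.cons_val_fin_one, map_sub, map_mul, map_pow, map_ofNat,
    ← MvPolynomial.algebraMap_eq, AlgHom.commutes]
  rfl

lemma coordRing_normalForm (f : CoordRing τ) :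
    ∃ p q : ℂ[X], f = aeval (wp τ) p + aeval (wp τ) q * wp' τ := by
  obtain ⟨f, rfl⟩ : ∃ a, CoordRing.mk τ a = f := Ideal.Quotient.mkₐ_surjective ℂ _ f
  induction f using MvPolynomial.induction_on with
  | C c =>
    refine ⟨C c, 0, ?_⟩
    rw [← MvPolynomial.algebraMap_eq, AlgHom.commutes, aeval_C, map_zero, zero_mul, add_zero]
  | add a b ha hb =>
    obtain ⟨p, q, ha⟩ := ha
    obtain ⟨p', q', hb⟩ := hb
    refine ⟨p + p', q + q', ?_⟩
    rw [map_add, ha, hb, map_add, map_add]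
    ring
  | mul_X a i ha =>
    obtain ⟨p, q, ha⟩ := ha
    rw [map_mul, ha]
    fin_cases i
    · refine ⟨p * X, q * X, ?_⟩
      rw [map_mul, map_mul, aeval_X]
      change _ * wp τ = _
      ring
    · refine ⟨q * (4 * X ^ 3 - C (periods τ).g₂ * X - C (periods τ).g₃), p, ?_⟩
      change _ * wp' τ = _
      simp only [map_mul, map_sub, map_pow, aeval_X, aeval_C, map_ofNat]
      rw [← wp'_sq]
      ring

/-- The right hand side of the equation of the curve. -/
def cubic : ℂ[X] := 4 * X ^ 3 - C (periods τ).g₂ * X - C (periods τ).g₃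

/-- The coordinate ring as a quadratic algebra over the polynomials in `u`. -/
def toQuadratic : CoordRing τ →ₐ[ℂ] QuadraticAlgebra ℂ[X] (cubic τ) 0 :=
  Ideal.Quotient.liftₐ (Ideal.span {curveEqn τ})
    -- Here u goes to the polynomial variable and v to the adjoined square root of `cubic`.
    (MvPolynomial.aeval ![algebraMap ℂ[X] _ X, ⟨0, 1⟩]) (by
      intro a ha
      obtain ⟨b, rfl⟩ := Ideal.mem_span_singleton'.mp ha
      rw [map_mul]
      convert mul_zero _
      simp only [curveEqn, map_sub, map_mul, map_pow, MvPolynomial.aeval_X, map_ofNat,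
        MvPolynomial.aeval_C, Matrix.cons_val_zero, Matrix.cons_val_one,
        Matrix.cons_val_fin_one]
      have h : (⟨0, 1⟩ : QuadraticAlgebra ℂ[X] (cubic τ) 0) ^ 2
          = algebraMap ℂ[X] _ (cubic τ) := by
        rw [pow_two, QuadraticAlgebra.mk_mul_mk, QuadraticAlgebra.algebraMap_eq]
        simp
      rw [h, cubic]
      simp only [map_sub, map_mul, map_pow, map_ofNat]
      rw [sub_eq_zero]
      rfl)

lemma toQuadratic_normalForm (p q : ℂ[X]) :
    toQuadratic τ (aeval (wp τ) p + aeval (wp τ) q * wp' τ) = ⟨p, q⟩ := by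
  have hu : toQuadratic τ (wp τ) = algebraMap ℂ[X] _ X := by
    refine (Ideal.Quotient.lift_mk _ _ _).trans ?_
    exact MvPolynomial.aeval_X _ 0
  have hv : toQuadratic τ (wp' τ) = ⟨0, 1⟩ := by
    refine (Ideal.Quotient.lift_mk _ _ _).trans ?_
    exact MvPolynomial.aeval_X _ 1
  have hp : ∀ p : ℂ[X], toQuadratic τ (aeval (wp τ) p) = algebraMap ℂ[X] _ p := by
    intro p
    rw [← aeval_algHom_apply, hu, aeval_algebraMap_apply, aeval_X_left_apply]
  rw [map_add, map_mul, hp, hp, hv, QuadraticAlgebra.algebraMap_eq, QuadraticAlgebra.algebraMap_eq]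
  ext <;> simp

/-- Uniqueness of the normal form: `toQuadratic` reads off p and q as coordinates. -/
lemma normalForm_eq_zero {p q : ℂ[X]} (h : aeval (wp τ) p + aeval (wp τ) q * wp' τ = 0) :
    p = 0 ∧ q = 0 := by
  have h' := toQuadratic_normalForm τ p q
  rw [h, map_zero] at h'
  exact ⟨(congrArg QuadraticAlgebra.re h').symm, (congrArg QuadraticAlgebra.im h').symm⟩

lemma der_aeval_wp (p : ℂ[X]) :
    der τ (aeval (wp τ) p) = aeval (wp τ) (derivative p) * wp' τ := by
  rw [← der_wp, ← smul_eq_mul]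
  exact (der τ).map_aeval p (wp τ)

/-- ∂_x exchanges the parts even and odd in v, so its kernel can be found separately on p and on q.
-/
lemma der_normalForm (p q : ℂ[X]) : der τ (aeval (wp τ) p + aeval (wp τ) q * wp' τ)
    = aeval (wp τ) (derivative q * cubic τ + q * (6 * X ^ 2 - C ((periods τ).g₂ / 2)))
      + aeval (wp τ) (derivative p) * wp' τ := by
  rw [map_add, Derivation.leibniz, der_aeval_wp, der_aeval_wp, der_wp', cubic]
  simp only [map_add, map_mul, map_sub, map_pow, aeval_X, aeval_C, map_ofNat, smul_eq_mul]
  rw [← wp'_sq]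
  ring

/-- If q had degree N and leading coefficient c ≠ 0, the top coefficient of the left side would be
(4N + 6)c ≠ 0. -/
lemma eq_zero_of_der_eq_zero {q : ℂ[X]}
    (h : derivative q * cubic τ + q * (6 * X ^ 2 - C ((periods τ).g₂ / 2)) = 0) : q = 0 := by
  by_contra hq
  -- The factor X replaces q' by Xq', of degree at most N with Nth coefficient Nc. This avoids the
  -- subtraction N - 1 and covers constant q.
  have hc := congrArg (fun r => (X * r).coeff (q.natDegree + 3)) h
  have hq' : (X * derivative q).natDegree ≤ q.natDegree := by
    rw [natDegree_le_iff_coeff_eq_zero]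
    intro k hk
    cases k with
    | zero => rw [coeff_X_mul_zero]
    | succ k => rw [coeff_X_mul, coeff_derivative, coeff_eq_zero_of_natDegree_lt hk, zero_mul]
  have hq'' : (X * derivative q).coeff q.natDegree = q.natDegree * q.leadingCoeff := by
    rw [leadingCoeff]
    rcases h : q.natDegree with _ | k
    · rw [coeff_X_mul_zero, Nat.cast_zero, zero_mul]
    · rw [coeff_X_mul, coeff_derivative]; push_cast; ring
  have hcub : (cubic τ).natDegree ≤ 3 := by rw [cubic]; compute_degree
  have hcub' : (cubic τ).coeff 3 = 4 := by rw [cubic]; compute_degree!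
  have hquad : (X * (6 * X ^ 2 - C ((periods τ).g₂ / 2))).natDegree ≤ 3 := by compute_degree
  have hquad' : (X * (6 * X ^ 2 - C ((periods τ).g₂ / 2))).coeff 3 = 6 := by compute_degree!
  simp only [mul_add, mul_zero, coeff_add, coeff_zero] at hc
  rw [← mul_assoc, mul_left_comm X q, coeff_mul_add_eq_of_natDegree_le hq' hcub,
    coeff_mul_add_eq_of_natDegree_le le_rfl hquad, hq'', hcub', hquad', coeff_natDegree] at hc
  have h3 : (4 * q.natDegree + 6 : ℂ) * q.leadingCoeff = 0 := by linear_combination hc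
  rcases mul_eq_zero.mp h3 with h4 | h4
  · have : (4 * q.natDegree + 6 : ℕ) = (0 : ℂ) := by push_cast; exact h4
    rw [Nat.cast_eq_zero] at this
    omega
  · exact hq (leadingCoeff_eq_zero.mp h4)

lemma exists_eq_algebraMap_of_der_eq_zero {f : CoordRing τ} (hf : der τ f = 0) :
    ∃ c : ℂ, f = algebraMap ℂ _ c := by
  obtain ⟨p, q, rfl⟩ := coordRing_normalForm τ f
  rw [der_normalForm] at hf
  obtain ⟨h1, h2⟩ := normalForm_eq_zero τ hf
  rw [eq_zero_of_der_eq_zero τ h1, eq_C_of_derivative_eq_zero h2]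
  exact ⟨p.coeff 0, by simp⟩

/-- Modulo the image of the derivation, the coordinate ring is spanned by `1` and `u`. -/
lemma exists_sub_eq_der (f : CoordRing τ) :
    ∃ (s t : ℂ) (g : CoordRing τ), f = s • 1 + t • wp τ + der τ g := by
  let N : Submodule ℂ (CoordRing τ) :=
    Submodule.span ℂ {1, wp τ} ⊔ LinearMap.range (der τ).toLinearMap
  have hder : ∀ g, der τ g ∈ N := fun g => Submodule.mem_sup_right ⟨g, rfl⟩
  have hpow : ∀ k, wp τ ^ k ∈ N := by
    intro k
    induction k using Nat.strong_induction_on with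
    | _ k ih =>
      match k with
      | 0 => exact Submodule.mem_sup_left (Submodule.subset_span (by simp))
      | 1 => exact Submodule.mem_sup_left (Submodule.subset_span (by simp))
      | 2 =>
        -- This is ∂_x v = 6u² - g₂/2 solved for u².
        have h : wp τ ^ 2 = (6 : ℂ)⁻¹ • (der τ (wp' τ) + ((periods τ).g₂ / 2) • 1) := by
          rw [der_wp', ← Algebra.algebraMap_eq_smul_one, sub_add_cancel,
            show (6 : CoordRing τ) = algebraMap ℂ _ 6 from (map_ofNat _ 6).symm,
            ← Algebra.smul_def, smul_smul, inv_mul_cancel₀ (by norm_num), one_smul]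
        rw [h]
        exact Submodule.smul_mem _ _ (add_mem (hder _) (Submodule.smul_mem _ _
          (by simpa using ih 0 (by norm_num))))
      | k + 3 =>
        have h0 : (4 * k + 10 : ℂ) ≠ 0 := by
          have : ((4 * k + 10 : ℕ) : ℂ) ≠ 0 := Nat.cast_ne_zero.mpr (by omega)
          exact_mod_cast this
        -- Expand ∂_x(u^{k+1}v) = (k+1)u^k v² + u^{k+1}(6u² - g₂/2) and substitute the curve
        -- equation; the coefficient 4(k+1) + 6 of u^{k+3} is nonzero.
        have h : (4 * k + 10 : ℂ) • wp τ ^ (k + 3) = der τ (wp τ ^ (k + 1) * wp' τ)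
            + ((k + 3 / 2) * (periods τ).g₂) • wp τ ^ (k + 1)
            + ((k + 1) * (periods τ).g₃) • wp τ ^ k := by
          have h2 : algebraMap ℂ (CoordRing τ) (periods τ).g₂
              = 2 * algebraMap ℂ _ ((periods τ).g₂ / 2) := by
            rw [← map_ofNat (algebraMap ℂ (CoordRing τ)) 2, ← map_mul]
            congr 1; ring
          have h3 : algebraMap ℂ (CoordRing τ) ((k + 3 / 2) * (periods τ).g₂)
              = (2 * k + 3) * algebraMap ℂ _ ((periods τ).g₂ / 2) := by
            rw [← map_ofNat (algebraMap ℂ (CoordRing τ)) 2,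
              ← map_ofNat (algebraMap ℂ (CoordRing τ)) 3,
              ← map_natCast (algebraMap ℂ (CoordRing τ)) k, ← map_mul, ← map_add, ← map_mul]
            congr 1; ring
          rw [Derivation.leibniz, Derivation.leibniz_pow, der_wp, der_wp',
            Algebra.smul_def (4 * k + 10 : ℂ), Algebra.smul_def ((k + 3 / 2) * (periods τ).g₂),
            Algebra.smul_def ((k + 1) * (periods τ).g₃), h3]
          simp only [smul_eq_mul, nsmul_eq_mul, map_add, map_mul, map_natCast, map_ofNat, map_one,
            Nat.add_sub_cancel]
          have hv := wp'_sq τ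
          rw [h2] at hv
          push_cast
          linear_combination (-(k + 1) * wp τ ^ k) * hv
        rw [← inv_smul_smul₀ h0 (wp τ ^ (k + 3)), h]
        exact Submodule.smul_mem _ _ (add_mem (add_mem (hder _)
          (Submodule.smul_mem _ _ (ih _ (by omega)))) (Submodule.smul_mem _ _ (ih _ (by omega))))
  have hpow' : ∀ k, wp τ ^ k * wp' τ ∈ N := by
    intro k
    have h0 : ((k + 1 : ℕ) : ℂ) ≠ 0 := Nat.cast_ne_zero.mpr k.succ_ne_zero
    -- The odd part is entirely exact, since v = ∂_x u.
    have h : ((k + 1 : ℕ) : ℂ) • (wp τ ^ k * wp' τ) = der τ (wp τ ^ (k + 1)) := by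
      rw [Derivation.leibniz_pow, der_wp, Nat.cast_smul_eq_nsmul]; rfl
    rw [← inv_smul_smul₀ h0 (wp τ ^ k * wp' τ), h]
    exact Submodule.smul_mem _ _ (hder _)
  have hf : f ∈ N := by
    obtain ⟨p, q, rfl⟩ := coordRing_normalForm τ f
    rw [aeval_eq_sum_range, aeval_eq_sum_range, Finset.sum_mul]
    refine add_mem (sum_mem fun k _ => Submodule.smul_mem _ _ (hpow k))
      (sum_mem fun k _ => ?_)
    rw [smul_mul_assoc]
    exact Submodule.smul_mem _ _ (hpow' k)
  obtain ⟨a, ha, _, ⟨g, rfl⟩, h⟩ := Submodule.mem_sup.mp hf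
  obtain ⟨s, t, rfl⟩ := Submodule.mem_span_pair.mp ha
  exact ⟨s, t, g, h.symm⟩

end CoordRing

/-! ### The cohomology of the curve in degrees 0, 1 and above -/

section Cohomology

variable {τ : ℍ}

lemma cvol_ne_zero (τ : ℍ) : cvol τ ≠ 0 := by
  intro h
  have him := congrArg Complex.im h
  have hτ := τ.im_pos
  simp only [cvol, Complex.sub_im, Complex.conj_im, Complex.zero_im, UpperHalfPlane.coe_im] at him
  linarith

section DeRham

variable {Γ : Type} [CommRing Γ] [Algebra ℂ Γ] (D : Derivation ℂ Γ Γ)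

lemma formClass_add (f g : Γ) : formClass D (f + g) = formClass D f + formClass D g := by
  apply Subtype.ext
  change FormCoh.mk D _ = FormCoh.mk D _ + FormCoh.mk D _
  rw [← map_add]
  congr 1
  exact Subtype.ext (TrivSqZeroExt.inr_add _ _ _)

lemma formClass_smul (c : ℂ) (f : Γ) : formClass D (c • f) = c • formClass D f := by
  apply Subtype.ext
  change FormCoh.mk D _ = c • FormCoh.mk D _
  rw [← map_smul]
  congr 1
  exact Subtype.ext (TrivSqZeroExt.inr_smul _ _ _)

lemma formClass_der (g : Γ) : formClass D (D g) = 0 := by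
  apply Subtype.ext
  exact Ideal.Quotient.eq_zero_iff_mem.mpr ⟨TrivSqZeroExt.inl g, rfl⟩

lemma formCohPiece_one_eq_formClass (η : formCohPiece D 1) : ∃ f, η = formClass D f := by
  obtain ⟨η, hη⟩ := η
  induction hη using Submodule.span_induction with
  | mem c h =>
    obtain ⟨⟨a, ha⟩, ⟨f, hf⟩, rfl⟩ := h
    exact ⟨f, Subtype.ext (congrArg (FormCoh.mk D) (Subtype.ext hf.symm))⟩
  | zero => exact ⟨0, by rw [← map_zero D, formClass_der]; rfl⟩
  | add a b ha hb h h' =>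
    obtain ⟨f, h⟩ := h
    obtain ⟨g, h'⟩ := h'
    exact ⟨f + g, by rw [formClass_add, ← h, ← h']; rfl⟩
  | smul c a ha h =>
    obtain ⟨f, h⟩ := h
    exact ⟨c • f, by rw [formClass_smul, ← h]; rfl⟩

lemma formCohPiece_add_two (k : ℕ) (η : formCohPiece D (k + 2)) : η = 0 := by
  obtain ⟨η, hη⟩ := η
  apply Subtype.ext
  change η = 0
  induction hη using Submodule.span_induction with
  | mem c h =>
    obtain ⟨⟨a, ha⟩, ha', rfl⟩ := h
    have h0 : (⟨a, ha⟩ : closedForms D) = 0 := Subtype.ext ha'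
    rw [h0, map_zero]
  | zero => rfl
  | add a b _ _ h h' => rw [h, h', add_zero]
  | smul c a _ h => rw [h, smul_zero]

lemma formCohPiece_zero_eq_algebraMap (hD : ∀ f, D f = 0 → ∃ c : ℂ, f = algebraMap ℂ Γ c)
    (η : formCohPiece D 0) : ∃ c : ℂ, (η : FormCoh D) = algebraMap ℂ _ c := by
  obtain ⟨η, hη⟩ := η
  change ∃ c : ℂ, η = algebraMap ℂ _ c
  induction hη using Submodule.span_induction with
  | mem c h =>
    obtain ⟨⟨a, ha⟩, ⟨f, hf⟩, rfl⟩ := h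
    change TrivSqZeroExt.inl f = a at hf
    subst hf
    obtain ⟨c, rfl⟩ := hD f (TrivSqZeroExt.inr_injective ha)
    refine ⟨c, ?_⟩
    rw [← AlgHom.commutes (FormCoh.mk D)]
    rfl
  | zero => exact ⟨0, (map_zero _).symm⟩
  | add a b _ _ h h' =>
    obtain ⟨c, rfl⟩ := h
    obtain ⟨c', rfl⟩ := h'
    exact ⟨c + c', (map_add _ _ _).symm⟩
  | smul r a _ h =>
    obtain ⟨c, rfl⟩ := h
    exact ⟨r * c, by rw [map_mul, Algebra.smul_def]⟩

end DeRham

lemma cohPiece_zero_eq_algebraMap (η : cohPiece τ 0) :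
    ∃ c : ℂ, (η : Coh τ) = algebraMap ℂ _ c :=
  formCohPiece_zero_eq_algebraMap _ (fun _ => exists_eq_algebraMap_of_der_eq_zero τ) η

/-- The classes [dx] and [u dx] span, and [dx̄] involves [u dx] with coefficient r = (τ̄ - τ)/2πi ≠
0, so it may replace [u dx]. -/
lemma cohPiece_one_eq (η : cohPiece τ 1) : ∃ s t : ℂ, η = s • dx τ + t • dxbar τ := by
  obtain ⟨f, rfl⟩ := formCohPiece_one_eq_formClass _ η
  obtain ⟨s, t, g, rfl⟩ := exists_sub_eq_der τ f
  set r : ℂ := cvol τ / (2 * Real.pi * Complex.I) with hr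
  have hr0 : r ≠ 0 := div_ne_zero (cvol_ne_zero τ) Complex.two_pi_I_ne_zero
  have hb : dxbar τ = r • formClass (der τ) (wp τ)
      + (r * EisensteinSeries.G2 τ + 1) • dx τ := by
    rw [dxbar, dx, formClass_add, formClass_smul, formClass_add,
      Algebra.algebraMap_eq_smul_one, formClass_smul, smul_add, smul_smul, add_smul, one_smul,
      add_assoc]
  -- Obtained by solving [dx̄] = r[u dx] + (rG₂ + 1)[dx] for [u dx].
  refine ⟨s - t / r * (r * EisensteinSeries.G2 τ + 1), t / r, ?_⟩
  rw [formClass_add, formClass_add, formClass_der, add_zero, formClass_smul, formClass_smul, hb,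
    smul_add, smul_smul, div_mul_cancel₀ _ hr0, smul_smul]
  have h : s • dx τ = (s - t / r * (r * EisensteinSeries.G2 τ + 1)) • dx τ
      + (t / r * (r * EisensteinSeries.G2 τ + 1)) • dx τ := by
    rw [← add_smul, sub_add_cancel]
  change s • dx τ + _ = _
  rw [h, add_assoc, add_comm (t • _)]

end Cohomology

/-! ### Relations in Totaro's algebra -/

namespace TotaroAlg

open GCAlg

variable {H : Type} [CommRing H] [Algebra ℂ H] {ℋ : ℕ → Submodule ℂ H} {n : ℕ}

lemma pull_add (i : Fin n) {k : ℕ} (η θ : ℋ k) : pull i (η + θ) = pull i η + pull i θ := by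
  have h := mk_eq_zero (deg := E2Gen.deg) (rels := {a | E2Rel ℋ n a}) (E2Rel.pull_add i k η θ)
  rw [map_sub, map_add] at h
  exact sub_eq_zero.mp h

lemma pull_smul (i : Fin n) {k : ℕ} (c : ℂ) (η : ℋ k) : pull i (c • η) = c • pull i η := by
  have h := mk_eq_zero (deg := E2Gen.deg) (rels := {a | E2Rel ℋ n a}) (E2Rel.pull_smul i k c η)
  rw [map_sub, map_smul] at h
  exact sub_eq_zero.mp h

lemma pull_one (i : Fin n) (η : ℋ 0) (hη : (η : H) = 1) : pull i η = 1 := by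
  have h := mk_eq_zero (deg := E2Gen.deg) (rels := {a | E2Rel ℋ n a}) (E2Rel.pull_one i η hη)
  rw [map_sub, map_one] at h
  exact sub_eq_zero.mp h

lemma pull_zero (i : Fin n) (k : ℕ) : pull i (0 : ℋ k) = 0 := by
  rw [← zero_smul ℂ (0 : ℋ k), pull_smul, zero_smul]

lemma G_self (i : Fin n) : G ℋ i i = 0 := dif_neg (not_not.mpr rfl)

lemma G_of_ne {i j : Fin n} (h : i ≠ j) : G ℋ i j = gen _ _ (E2Gen.G i j h) := dif_pos h

lemma G_symm (i j : Fin n) : G ℋ i j = G ℋ j i := by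
  by_cases hij : i = j
  · rw [hij]
  · have h := mk_eq_zero (deg := E2Gen.deg) (rels := {a | E2Rel ℋ n a}) (E2Rel.G_symm i j hij)
    rw [map_sub] at h
    rw [G_of_ne hij, G_of_ne (Ne.symm hij)]
    exact sub_eq_zero.mp h

lemma pull_mem (i : Fin n) {k : ℕ} (η : ℋ k) : pull i η ∈ grading ℋ n k :=
  gen_mem_piece (deg' := E2Gen.deg) (E2Gen.pull i k η)

lemma G_mem (i j : Fin n) : G ℋ i j ∈ grading ℋ n 1 := by
  by_cases hij : i = j
  · rw [hij, G_self]; exact zero_mem _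
  · rw [G_of_ne hij]
    exact gen_mem_piece (deg' := E2Gen.deg) (E2Gen.G i j hij)

lemma G_mul_self (i j : Fin n) : G ℋ i j * G ℋ i j = 0 := mul_self_of_mem (G_mem i j)

lemma pull_sub_pull_mul_G (i j : Fin n) {k : ℕ} (η : ℋ k) :
    (pull i η - pull j η) * G ℋ i j = 0 := by
  by_cases hij : i = j
  · rw [hij, G_self, mul_zero]
  · have h := mk_eq_zero (deg := E2Gen.deg) (rels := {a | E2Rel ℋ n a})
      (E2Rel.G_pull i j hij k η)
    rw [map_mul, map_sub] at h
    rw [G_of_ne hij]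
    exact h

/-- The Fay relations are imposed for all triples, so the Arnold relation is needed for coinciding
indices too; there it reduces to G_ii = 0 and G_ij² = 0. -/
lemma G_arnold (i j l : Fin n) :
    G ℋ i l * G ℋ j l + G ℋ j i * G ℋ i l + G ℋ j l * G ℋ i j = 0 := by
  by_cases hij : i = j
  · subst hij
    rw [G_self, G_mul_self, zero_mul, mul_zero, add_zero, add_zero]
  by_cases hil : i = l
  · subst hil
    rw [G_self, G_symm j i, G_mul_self, zero_mul, mul_zero, add_zero, add_zero]
  by_cases hjl : j = l
  · subst hjl
    rw [G_self, G_symm j i, G_mul_self, zero_mul, mul_zero, add_zero, add_zero]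
  have h := mk_eq_zero (deg := E2Gen.deg) (rels := {a | E2Rel ℋ n a})
    (E2Rel.G_arnold i j l hij hjl (Ne.symm hil))
  simp only [map_add, map_mul, mk_ι, ← G_of_ne] at h
  rw [G_symm i j, G_symm l i, G_symm l j] at h
  rw [G_symm i j, ← h]
  abel

lemma homogeneousRels : HomogeneousRels E2Gen.deg {a | E2Rel ℋ n a} := by
  have hι : ∀ (x : E2Gen ℋ n) (m : ℕ), x.deg = m → FreeAlgebra.ι ℂ x ∈ freePiece E2Gen.deg m :=
    fun x m h => h ▸ ι_mem_freePiece x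
  have hιι : ∀ (x y : E2Gen ℋ n) (m : ℕ), x.deg + y.deg = m →
      FreeAlgebra.ι ℂ x * FreeAlgebra.ι ℂ y ∈ freePiece E2Gen.deg m :=
    fun x y m h => h ▸ ι_mul_ι_mem_freePiece x y
  intro a ha
  cases ha with
  | pull_add i k η θ =>
    exact ⟨k, Submodule.sub_mem _ (hι _ k rfl)
      (Submodule.add_mem _ (hι _ k rfl) (hι _ k rfl))⟩
  | pull_smul i k c η =>
    exact ⟨k, Submodule.sub_mem _ (hι _ k rfl) (Submodule.smul_mem _ _ (hι _ k rfl))⟩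
  | pull_one i η hη => exact ⟨0, Submodule.sub_mem _ (hι _ 0 rfl) one_mem_freePiece⟩
  | pull_mul i k l η θ ξ hξ =>
    exact ⟨k + l, Submodule.sub_mem _ (hι _ (k + l) rfl) (hιι _ _ (k + l) rfl)⟩
  | G_symm i j hij => exact ⟨1, Submodule.sub_mem _ (hι _ 1 rfl) (hι _ 1 rfl)⟩
  | G_sq i j hij => exact ⟨2, hιι _ _ 2 rfl⟩
  | G_arnold i j k hij hjk hki =>
    exact ⟨2, Submodule.add_mem _ (Submodule.add_mem _ (hιι _ _ 2 rfl) (hιι _ _ 2 rfl))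
      (hιι _ _ 2 rfl)⟩
  | G_pull i j hij k η =>
    rw [sub_mul]
    exact ⟨k + 1, Submodule.sub_mem _ (hιι _ _ (k + 1) rfl) (hιι _ _ (k + 1) rfl)⟩

end TotaroAlg

/-! ### The differential of E_2(n) -/

namespace E2

open GCAlg TotaroAlg

variable {τ : ℍ} {n : ℕ}

lemma pull_sub_pull_mem (i j : Fin n) (η : cohPiece τ 1) :
    pull i η - pull j η ∈ grading τ n 1 := sub_mem (pull_mem i η) (pull_mem j η)

lemma G_symm (i j : Fin n) : G τ i j = G τ j i := TotaroAlg.G_symm i j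

lemma G_of_ne {i j : Fin n} (h : i ≠ j) : G τ i j = gen _ _ (E2Gen.G i j h) :=
  TotaroAlg.G_of_ne h

lemma diag_mem (i j : Fin n) : diag τ i j ∈ grading τ n 2 :=
  Submodule.smul_mem _ _ (mul_mem_piece (m := 1) (m' := 1) (pull_sub_pull_mem i j _)
    (pull_sub_pull_mem i j _))

lemma sub_mul_sub_comm' {S : Type} [Ring S] (a b c d : S) :
    (a - b) * (c - d) = (b - a) * (d - c) := by noncomm_ring

lemma diag_symm (i j : Fin n) : diag τ i j = diag τ j i :=
  congrArg _ (sub_mul_sub_comm' _ _ _ _)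

lemma diag_self (i : Fin n) : diag τ i i = 0 := by
  rw [diag, sub_self, zero_mul, smul_zero]

lemma diag_comm_G (i j k l : Fin n) : G τ i j * diag τ k l = diag τ k l * G τ i j := by
  rw [mul_comm_of_mem (G_mem i j) (diag_mem k l)]
  simp

lemma mul_eq_of_sub_mul {S : Type} [Ring S] {a a' a'' b b' b'' g : S} (ha : (a - a') * g = 0)
    (hb : (b - b') * g = 0) (hg : (b' - b'') * g = -(g * (b' - b''))) :
    (a - a'') * (b - b'') * g = (a' - a'') * (b' - b'') * g := by
  have hb' : (b - b'') * g = (b' - b'') * g := by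
    rw [← sub_eq_zero, ← sub_mul, sub_sub_sub_cancel_right, hb]
  have ha' : (a - a'') * g = (a' - a'') * g := by
    rw [← sub_eq_zero, ← sub_mul, sub_sub_sub_cancel_right, ha]
  rw [mul_assoc, hb', hg, mul_neg, ← mul_assoc, ha', mul_assoc, mul_assoc, ← mul_neg, ← hg]

/-- Multiplication by G_ik identifies the pullbacks along i and k, and this applies to both factors
of the diagonal class once G_ik has been moved past the second. -/
lemma diag_mul_G (i j k : Fin n) : diag τ i j * G τ i k = diag τ k j * G τ i k := by
  rw [diag, diag, smul_mul_assoc, smul_mul_assoc]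
  congr 1
  exact mul_eq_of_sub_mul (pull_sub_pull_mul_G i k (dx τ)) (pull_sub_pull_mul_G i k (dxbar τ))
    (mul_anticomm_of_mem (pull_sub_pull_mem k j _) (G_mem i k))

/-- Classes of degree zero are constants, and each π_i^* is unital. -/
lemma pull_zero_eq (i j : Fin n) (η : cohPiece τ 0) : pull i η = pull j η := by
  obtain ⟨c, hc⟩ := cohPiece_zero_eq_algebraMap η
  have hone : (1 : Coh τ) ∈ cohPiece τ 0 := Submodule.subset_span
    ⟨1, ⟨1, rfl⟩, (map_one (FormCoh.mk (der τ))).symm⟩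
  have h : η = c • ⟨1, hone⟩ := by
    apply Subtype.ext
    rw [hc, Algebra.algebraMap_eq_smul_one]; rfl
  rw [h, pull, pull, pull_smul, pull_smul, pull_one i _ rfl, pull_one j _ rfl]

lemma mul_mul_eq_zero {S : Type} [Ring S] {a b : S} (ha : a * a = 0) (hb : b * b = 0)
    (hab : b * a = -(a * b)) : a * (a * b) = 0 ∧ b * (a * b) = 0 := by
  constructor
  · rw [← mul_assoc, ha, zero_mul]
  · rw [← mul_assoc, hab, neg_mul, mul_assoc, hb, mul_zero, neg_zero]

/-- In degree one the difference is a combination of the two odd factors of Δ_ij, each of which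
squares to zero. In degree zero the difference vanishes, and above degree one so does η. -/
lemma pull_sub_pull_mul_diag (i j : Fin n) {k : ℕ} (η : cohPiece τ k) :
    (pull i η - pull j η) * diag τ i j = 0 := by
  match k, η with
  | 0, η => rw [pull_zero_eq i j η, sub_self, zero_mul]
  | 1, η =>
    obtain ⟨s, t, rfl⟩ := cohPiece_one_eq η
    have h : pull i (s • dx τ + t • dxbar τ) - pull j (s • dx τ + t • dxbar τ)
        = s • (pull i (dx τ) - pull j (dx τ)) + t • (pull i (dxbar τ) - pull j (dxbar τ)) := by
      rw [pull, pull, pull_add, pull_add, pull_smul, pull_smul, pull_smul, pull_smul, smul_sub,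
        smul_sub]
      abel
    obtain ⟨h1, h2⟩ := mul_mul_eq_zero (mul_self_of_mem (pull_sub_pull_mem i j (dx τ)))
      (mul_self_of_mem (pull_sub_pull_mem i j (dxbar τ)))
      (mul_anticomm_of_mem (pull_sub_pull_mem i j (dxbar τ)) (pull_sub_pull_mem i j (dx τ)))
    rw [h, diag, mul_smul_comm, add_mul, smul_mul_assoc, smul_mul_assoc, h1, h2, smul_zero,
      smul_zero, add_zero, smul_zero]
  | k + 2, η =>
    rw [formCohPiece_add_two _ k η, pull, pull, pull_zero, pull_zero, sub_self, zero_mul]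

/-! #### The differential -/

variable (τ n) in
/-- The values of the differential on the generators. -/
def dGen : E2Gen (cohPiece τ) n → E2 τ n
  | .pull _ _ _ => 0
  | .G i j _ => diag τ i j

lemma dGen_mem (x : E2Gen (cohPiece τ) n) : dGen τ n x ∈ grading τ n (x.deg + 1) := by
  cases x with
  | pull i k η => exact zero_mem _
  | G i j hij => exact diag_mem i j

lemma freeDer_pull_mul (i : Fin n) (k : ℕ) (η : cohPiece τ k) (x : E2Gen (cohPiece τ) n) :
    freeDer (dGen τ n) (FreeAlgebra.ι ℂ (.pull i k η) * FreeAlgebra.ι ℂ x)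
      = (-1 : ℂ) ^ k • (pull i η * dGen τ n x) := by
  rw [freeDer_ι_mul_ι, dGen, zero_mul, zero_add]
  rfl

lemma freeDer_G_mul_G {i j k l : Fin n} (hij : i ≠ j) (hkl : k ≠ l) :
    freeDer (dGen τ n) (FreeAlgebra.ι ℂ (.G i j hij) * FreeAlgebra.ι ℂ (.G k l hkl))
      = diag τ i j * G τ k l - diag τ k l * G τ i j := by
  have hdeg : (E2Gen.G i j hij : E2Gen (cohPiece τ) n).deg = 1 := rfl
  rw [freeDer_ι_mul_ι, ← diag_comm_G i j, E2.G_of_ne hij, E2.G_of_ne hkl,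
    sub_eq_add_neg, ← neg_one_smul', hdeg, pow_one]
  rfl

lemma freeDer_rel (a : FreeAlgebra ℂ (E2Gen (cohPiece τ) n)) (ha : E2Rel (cohPiece τ) n a) :
    freeDer (dGen τ n) a = 0 := by
  cases ha with
  | pull_add i k η θ => simp [dGen]
  | pull_smul i k c η => simp [dGen]
  | pull_one i η hη => simp [dGen]
  | pull_mul i k l η θ ξ hξ =>
    rw [map_sub, freeDer_pull_mul, freeDer_ι, dGen, dGen, mul_zero, smul_zero, sub_zero]
  | G_symm i j hij => rw [map_sub, freeDer_ι, freeDer_ι, dGen, dGen, diag_symm, sub_self]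
  | G_sq i j hij => rw [freeDer_G_mul_G, sub_self]
  | G_arnold i j k hij hjk hki =>
    -- Of the six terms ±ΔG, the three positive ones are rewritten by `diag_mul_G`; each then
    -- cancels a negative term with the same G.
    rw [map_add, map_add, freeDer_G_mul_G, freeDer_G_mul_G, freeDer_G_mul_G, diag_mul_G i j k,
      diag_mul_G j k i, diag_mul_G k i j, E2.G_symm k i, E2.G_symm k j,
      E2.G_symm j i, diag_symm j i]
    abel
  | G_pull i j hij k η =>
    have h := congrArg (fun a => (-1 : ℂ) ^ k • a) (pull_sub_pull_mul_diag i j η)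
    simp only [sub_mul, smul_sub, smul_zero] at h
    rw [sub_mul, map_sub, freeDer_pull_mul, freeDer_pull_mul]
    exact h

lemma derivation_values {d : E2 τ n →ₗ[ℂ] E2 τ n} (hd : IsDifferential τ n d)
    (x : E2Gen (cohPiece τ) n) : d (gen _ _ x) = dGen τ n x := by
  cases x with
  | pull i k η => exact hd.bideg_zero k _ (gen_mem_piece (deg' := E2Gen.bideg) (.pull i k η))
  | G i j hij =>
    rw [← E2.G_of_ne hij]
    exact hd.d_G i j hij

lemma diag_mem_bigrading (i j : Fin n) : diag τ i j ∈ bigrading τ n (2, 0) := by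
  have h : ∀ (i : Fin n) (η : cohPiece τ 1), pull i η ∈ bigrading τ n (1, 0) := fun i η =>
    gen_mem_piece (deg' := E2Gen.bideg) (E2Gen.pull i 1 η)
  exact Submodule.smul_mem _ _ (mul_mem_piece (m := (1, 0)) (m' := (1, 0))
    (sub_mem (h i _) (h j _)) (sub_mem (h i _) (h j _)))

/-- The bidegree (2, -1) is split into two claims because degrees are natural numbers. They are
proved together: after a leading G_ij the rest of the word may contain no G, and then the first
claim is needed. -/
lemma derivation_word_bigrading {d : E2 τ n →ₗ[ℂ] E2 τ n}
    (hgen : ∀ x, d (gen _ _ x) = dGen τ n x)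
    (hd : ∀ p, ∀ a ∈ grading τ n p, ∀ b, d (a * b) = d a * b + (-1 : ℂ) ^ p • (a * d b))
    (w : List (E2Gen (cohPiece τ) n)) :
    (∀ p, (w.map E2Gen.bideg).sum = (p, 0) → d (word _ _ w) = 0) ∧
    ∀ p q, (w.map E2Gen.bideg).sum = (p, q + 1) → d (word _ _ w) ∈ bigrading τ n (p + 2, q) := by
  induction w with
  | nil =>
    have h1 : d (word _ _ []) = 0 := derivation_one hd
    exact ⟨fun _ _ => h1, fun _ _ _ => by rw [h1]; exact zero_mem _⟩
  | cons x w ih =>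
    have hcons := derivation_gen_mul hd x (word _ _ w)
    rw [word_cons, hcons, hgen, List.map_cons, List.sum_cons]
    have hx : gen _ _ x ∈ bigrading τ n x.bideg := gen_mem_piece (deg' := E2Gen.bideg) x
    cases hw : (w.map E2Gen.bideg).sum with
    | mk r s =>
    cases x with
    | pull i k η =>
      rw [dGen, zero_mul, zero_add, E2Gen.bideg]
      constructor
      · intro p h
        have hs : s = 0 := by simpa using congrArg Prod.snd h
        rw [ih.1 r (by rw [hw, hs]), mul_zero, smul_zero]
      · intro p q h
        obtain ⟨rfl, hs⟩ : k + r = p ∧ 0 + s = q + 1 := Prod.mk.inj h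
        rw [zero_add] at hs
        refine Submodule.smul_mem _ _ ?_
        have h' := mul_mem_piece hx (ih.2 r q (by rw [hw, hs]))
        rwa [E2Gen.bideg, Prod.mk_add_mk, zero_add, ← add_assoc] at h'
    | G i j hij =>
      rw [dGen, E2Gen.bideg]
      constructor
      · intro p h
        have hs : 1 + s = 0 := congrArg Prod.snd h
        omega
      · intro p q h
        obtain ⟨hr, hs⟩ : 0 + r = p ∧ 1 + s = q + 1 := Prod.mk.inj h
        obtain rfl : r = p := by omega
        obtain rfl : s = q := by omega
        refine add_mem ?_ (Submodule.smul_mem _ _ ?_)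
        · have h' := mul_mem_piece (diag_mem_bigrading (τ := τ) i j)
            (word_mem_piece (deg' := E2Gen.bideg) w)
          rwa [hw, Prod.mk_add_mk, zero_add, add_comm 2 r] at h'
        · cases s with
          | zero => rw [ih.1 r hw, mul_zero]; exact zero_mem _
          | succ s =>
            have h' := mul_mem_piece hx (ih.2 r s hw)
            rwa [E2Gen.bideg, Prod.mk_add_mk, zero_add, add_comm 1 s] at h'

lemma existsUnique_differential : ∃! d : E2 τ n →ₗ[ℂ] E2 τ n, IsDifferential τ n d := by
  obtain ⟨d, hgen, hd⟩ := exists_derivation TotaroAlg.homogeneousRels dGen_mem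
    (freeDer_rel (τ := τ) (n := n))
  have hpull : ∀ (i : Fin n) (η : cohPiece τ 1), d (pull i η) = 0 := fun i η =>
    hgen (.pull i 1 η)
  have hsub : ∀ (i j : Fin n) (η : cohPiece τ 1), d (pull i η - pull j η) = 0 := fun i j η => by
    rw [map_sub, hpull, hpull, sub_zero]
  refine ⟨d, ⟨isCDGA_of_derivation TotaroAlg.homogeneousRels hd
    (fun x => by rw [hgen]; exact dGen_mem x) (fun x => ?_), fun p q a ha => ?_,
    fun p a ha => ?_, fun i j hij => ?_⟩,
    fun d' hd' => derivation_ext hd'.isCDGA.leibniz hd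
      fun x => by rw [derivation_values hd', hgen]⟩
  · rw [hgen]
    cases x with
    | pull i k η => exact map_zero d
    | G i j hij =>
      rw [dGen, diag, map_smul, hd 1 _ (pull_sub_pull_mem i j _), hsub, hsub, zero_mul, mul_zero,
        smul_zero, add_zero, smul_zero]
  · exact piece_induction (P := fun a => d a ∈ bigrading τ n (p + 2, q))
      (fun w hw => (derivation_word_bigrading hgen hd w).2 p q hw)
      (by rw [map_zero]; exact zero_mem _)
      (fun a b h h' => by rw [map_add]; exact add_mem h h')
      (fun c a h => by rw [map_smul]; exact Submodule.smul_mem _ c h) ha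
  · exact piece_induction (P := fun a => d a = 0)
      (fun w hw => (derivation_word_bigrading hgen hd w).1 p hw) (map_zero d)
      (fun a b h h' => by rw [map_add, h, h', add_zero])
      (fun c a h => by rw [map_smul, h, smul_zero]) ha
  · rw [E2.G_of_ne hij]
    exact hgen (.G i j hij)

end E2

/-! ### The Fay relation for series of the form a + αg -/

section Fay

open MvPowerSeries

variable {A : Type} [Ring A]

/-- The sequence `a, g, 0, 0, …`. -/
def linSeq (a g : A) : ℕ → A
  | 0 => a
  | 1 => g
  | _ => 0

lemma linSeq_eq (a g : A) (m : ℕ) :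
    linSeq a g m = (if m = 0 then a else 0) + shift 1 (fun k => if k = 0 then g else 0) m := by
  rcases m with _ | _ | m <;> simp [linSeq, shift]

lemma serA_ite (a : A) : serA (fun k => if k = 0 then a else 0) = C a := by
  classical
  ext e
  have he : e = 0 ↔ e 1 = 0 ∧ e 0 = 0 := by
    rw [Finsupp.ext_iff, Fin.forall_fin_two]; exact and_comm
  rw [coeff_serA, coeff_C, if_congr he rfl rfl, ite_and]

lemma serB_ite (a : A) : serB (fun k => if k = 0 then a else 0) = C a := by
  classical
  ext e
  have he : e = 0 ↔ e 0 = 0 ∧ e 1 = 0 := by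
    rw [Finsupp.ext_iff, Fin.forall_fin_two]; rfl
  rw [coeff_serB, coeff_C, if_congr he rfl rfl, ite_and]

lemma serAB_ite (a : A) : serAB (fun k => if k = 0 then a else 0) = C a := by
  classical
  ext e
  have he : e = 0 ↔ e 0 + e 1 = 0 := by
    rw [Finsupp.ext_iff, Fin.forall_fin_two, Nat.add_eq_zero_iff]; rfl
  rw [coeff_serAB, coeff_C, if_congr he rfl rfl]
  split_ifs with h
  · rw [h, (Nat.add_eq_zero_iff.mp h).1, Nat.choose_self, one_smul]
  · rw [smul_zero]

lemma serA_linSeq (a g : A) : serA (linSeq a g) = C a + X 0 * C g := by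
  rw [← serA_ite a, ← serA_ite g, ← one_mul (serA fun k => if k = 0 then g else 0), ← map_one C,
    ← serA_shift]
  ext e
  rw [map_add, coeff_serA, coeff_serA, coeff_serA, linSeq_eq]
  split_ifs <;> simp

lemma serB_linSeq (a g : A) : serB (linSeq a g) = C a + X 1 * C g := by
  rw [← serB_ite a, ← serB_ite g, ← one_mul (serB fun k => if k = 0 then g else 0), ← map_one C,
    ← serB_shift]
  ext e
  rw [map_add, coeff_serB, coeff_serB, coeff_serB, linSeq_eq]
  split_ifs <;> simp

lemma serAB_linSeq (a g : A) : serAB (linSeq a g) = C a + (X 0 + X 1) * C g := by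
  rw [← serAB_ite a, ← serAB_ite g, ← one_mul (serAB fun k => if k = 0 then g else 0),
    ← map_one C, ← serAB_shift]
  ext e
  rw [map_add, coeff_serAB, coeff_serAB, coeff_serAB, linSeq_eq, smul_add]

/-- Only x and y are central, so the order of the other factors is kept. The right side is grouped
so that each bracket is a sum of expressions assumed zero in `fay_linear`. -/
lemma fay_expand {S : Type} [Ring S] {x y : S} (hx : ∀ s, Commute x s) (hy : ∀ s, Commute y s)
    (p q r s P Q R T : S) :
    (x + y) * ((p + x * P) * (q + y * Q)) + x * ((r + y * R) * (p + (x + y) * P))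
        + y * ((q + (x + y) * Q) * (s + x * T))
      = x * (p * q + r * p) + y * (p * q + q * s) + x * (x * (P * q + r * P))
        + y * (y * (p * Q + Q * s)) + x * (y * ((P * q + r * P) + (p * Q + Q * s)
        + (R * p + q * T))) + x * ((x + y) * (y * (P * Q + R * P + Q * T))) := by
  have h1 : ∀ a b, a * (x * b) = x * (a * b) := fun a b => ((hx a).left_comm b).symm
  have h2 : ∀ a b, a * (y * b) = y * (a * b) := fun a b => ((hy a).left_comm b).symm
  simp only [mul_add, add_mul, mul_assoc, h1 q, h1 r, h1 Q, h1 R, h1 y, h2 p, h2 r, h2 P,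
    h2 R]
  abel

/-- The three-term relation for series of degree one. -/
lemma fay_linear (p q r s P Q R T : A) (h1 : p * q + r * p = 0)
    (h2 : p * q + q * s = 0) (h3 : P * q + r * P = 0) (h4 : p * Q + Q * s = 0)
    (h5 : R * p + q * T = 0) (h6 : P * Q + R * P + Q * T = 0) :
    (X 0 + X 1) * (serA (linSeq p P) * serB (linSeq q Q))
      + X 0 * (serB (linSeq r R) * serAB (linSeq p P))
      + X 1 * (serAB (linSeq q Q) * serA (linSeq s T)) = 0 := by
  rw [serA_linSeq, serA_linSeq, serB_linSeq, serB_linSeq, serAB_linSeq, serAB_linSeq,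
    fay_expand (fun f => (commute_X f 0).symm) (fun f => (commute_X f 1).symm)]
  simp only [← map_mul, ← map_add, h1, h2, h3, h4, h5, h6, map_zero, mul_zero, add_zero]

end Fay

/-! ### The morphism ψ -/

namespace E2

open GCAlg TotaroAlg MvPowerSeries

variable {τ : ℍ} {n : ℕ}

/-- Anticommuting turns the sum into p(q - r) = p². The four variants below use the same trick,
three of them with one factor G, which is annihilated by its own difference. -/
lemma three_term_zero {S : Type} [Ring S] {p q r : S} (h : q - r = p) (hp : p * p = 0)
    (hr : r * p = -(p * r)) : p * q + r * p = 0 := by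
  rw [hr, ← sub_eq_add_neg, ← mul_sub, h, hp]

lemma three_term_zero' {S : Type} [Ring S] {p q s : S} (h : p - s = q) (hq : q * q = 0)
    (hs : q * s = -(s * q)) : p * q + q * s = 0 := by
  rw [hs, ← sub_eq_add_neg, ← sub_mul, h, hq]

lemma three_term_left {S : Type} [Ring S] {p q r g : S} (h : q - r = p) (hg : p * g = 0)
    (hp : g * p = -(p * g)) (hr : r * g = -(g * r)) : g * q + r * g = 0 := by
  rw [hr, ← sub_eq_add_neg, ← mul_sub, h, hp, hg, neg_zero]

lemma three_term_right {S : Type} [Ring S] {p q s g : S} (h : p - s = q) (hg : q * g = 0)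
    (hs : g * s = -(s * g)) : p * g + g * s = 0 := by
  rw [hs, ← sub_eq_add_neg, ← sub_mul, h, hg]

lemma three_term_middle {S : Type} [Ring S] {p q s g : S} (h : p - q = s) (hg : s * g = 0)
    (hs : g * s = -(s * g)) (hq : q * g = -(g * q)) : g * p + q * g = 0 := by
  rw [hq, ← sub_eq_add_neg, ← mul_sub, h, hs, hg, neg_zero]

variable (τ n) in
/-- The images of the sequences `ω_ij^{(m)}`. -/
def ommSeq (i j : Fin n) : ℕ → E2 τ n := linSeq (pull i (dx τ) - pull j (dx τ)) (G τ i j)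

lemma fay_ommSeq (i j l : Fin n) :
    (X 0 + X 1) * (serA (ommSeq τ n i l) * serB (ommSeq τ n j l))
      + X 0 * (serB (ommSeq τ n j i) * serAB (ommSeq τ n i l))
      + X 1 * (serAB (ommSeq τ n j l) * serA (ommSeq τ n i j)) = 0 := by
  have ha : ∀ i j : Fin n, pull i (dx τ) - pull j (dx τ) ∈ grading τ n 1 := fun i j =>
    pull_sub_pull_mem i j _
  have hG : ∀ i j : Fin n, G τ i j ∈ grading τ n 1 := G_mem
  have haG : ∀ i j : Fin n, (pull i (dx τ) - pull j (dx τ)) * G τ i j = 0 := fun i j =>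
    pull_sub_pull_mul_G i j _
  have e1 : (pull j (dx τ) - pull l (dx τ)) - (pull j (dx τ) - pull i (dx τ))
      = pull i (dx τ) - pull l (dx τ) := by abel
  have e2 : (pull i (dx τ) - pull l (dx τ)) - (pull i (dx τ) - pull j (dx τ))
      = pull j (dx τ) - pull l (dx τ) := by abel
  have e3 : (pull i (dx τ) - pull l (dx τ)) - (pull j (dx τ) - pull l (dx τ))
      = pull i (dx τ) - pull j (dx τ) := by abel
  refine fay_linear _ _ _ _ _ _ _ _ ?_ ?_ ?_ ?_ ?_ (G_arnold i j l)
  · exact three_term_zero e1 (mul_self_of_mem (ha i l)) (mul_anticomm_of_mem (ha j i) (ha i l))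
  · exact three_term_zero' e2 (mul_self_of_mem (ha j l)) (mul_anticomm_of_mem (ha j l) (ha i j))
  · exact three_term_left e1 (haG i l) (mul_anticomm_of_mem (hG i l) (ha i l))
      (mul_anticomm_of_mem (ha j i) (hG i l))
  · exact three_term_right e2 (haG j l) (mul_anticomm_of_mem (hG j l) (ha i j))
  · rw [E2.G_symm j i]
    exact three_term_middle e3 (haG i j) (mul_anticomm_of_mem (hG i j) (ha i j))
      (mul_anticomm_of_mem (ha j l) (hG i j))

/-! #### The morphism -/

variable (τ n) in
/-- The images of the generators of `Ξ_n`. -/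
def psiGen : XiGen n → E2 τ n
  | .om i => pull i (dx τ)
  | .nu i => (-(1 / ((starRingEnd ℂ) (τ : ℂ) - (τ : ℂ)))) • pull i (dxbar τ)
  | .omm i j m => ommSeq τ n i j m

lemma ommSeq_mem (i j : Fin n) (m : ℕ) : ommSeq τ n i j m ∈ grading τ n 1 := by
  rcases m with _ | _ | m
  · exact pull_sub_pull_mem i j _
  · exact G_mem i j
  · exact zero_mem _

lemma psiGen_mem (x : XiGen n) : psiGen τ n x ∈ grading τ n 1 := by
  cases x with
  | om i => exact pull_mem i _
  | nu i => exact Submodule.smul_mem _ _ (pull_mem i _)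
  | omm i j m => exact ommSeq_mem i j m

lemma ommSeq_symm (i j : Fin n) (m : ℕ) :
    ommSeq τ n i j m + (-1 : ℂ) ^ m • ommSeq τ n j i m = 0 := by
  rcases m with _ | _ | m
  · rw [pow_zero, one_smul]
    change pull i (dx τ) - pull j (dx τ) + (pull j (dx τ) - pull i (dx τ)) = 0
    rw [sub_add_sub_cancel, sub_self]
  · rw [zero_add, pow_one, neg_one_smul']
    change G τ i j + -G τ j i = 0
    rw [E2.G_symm j i, add_neg_cancel]
  · change (0 : E2 τ n) + (-1 : ℂ) ^ (m + 2) • (0 : E2 τ n) = 0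
    rw [smul_zero, add_zero]

lemma lift_psiGen_fay (i j l : Fin n) (e : Fin 2 →₀ ℕ) :
    FreeAlgebra.lift ℂ (psiGen τ n) (coeff e (fay i j l)) = 0 := by
  have h := (map_fay (FreeAlgebra.lift ℂ (psiGen τ n)).toRingHom (w := ommSeq τ n)
    (fun _ _ _ => FreeAlgebra.lift_ι_apply _ _) i j l).trans (fay_ommSeq i j l)
  exact congrArg (coeff e) h

lemma lift_psiGen_rel (a : FreeAlgebra ℂ (XiGen n)) (ha : XiRel n a) :
    FreeAlgebra.lift ℂ (psiGen τ n) a = 0 := by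
  cases ha with
  | symm i j m =>
    rw [map_add, map_smul, FreeAlgebra.lift_ι_apply, FreeAlgebra.lift_ι_apply]
    exact ommSeq_symm i j m
  | zero i j =>
    rw [map_sub, map_sub, FreeAlgebra.lift_ι_apply, FreeAlgebra.lift_ι_apply,
      FreeAlgebra.lift_ι_apply]
    exact sub_self _
  | fay i j l e => exact lift_psiGen_fay i j l e

variable (τ n) in
/-- The homomorphism `ψ : Ξ_n → E_2(n)`. -/
def psi : Xi n →ₐ[ℂ] E2 τ n :=
  GCAlg.lift (psiGen τ n) (fun x y => mul_comm_of_mem (psiGen_mem x) (psiGen_mem y))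
    (fun a ha => lift_psiGen_rel a ha)

lemma psi_gen (x : XiGen n) : psi τ n (gen _ _ x) = psiGen τ n x := lift_gen _ _ _ x

/-- This fixes the sign in ψ(ν_i): swapping the odd factors [dx̄_i] - [dx̄_j] and [dx_i] - [dx_j]
cancels the minus sign and leaves Δ_ij. -/
lemma sub_mul_sub_anticomm {S : Type} [Ring S] [Algebra ℂ S] {c : ℂ} {a a' b b' : S}
    (h : (b - b') * (a - a') = -((a - a') * (b - b'))) :
    ((-(1 / c)) • b - (-(1 / c)) • b') * (a - a') = c⁻¹ • ((a - a') * (b - b')) := by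
  rw [← smul_sub, smul_mul_assoc, h, smul_neg, neg_smul, neg_neg, one_div]

lemma smul_sub_smul_mul_eq_zero {S : Type} [Ring S] [Algebra ℂ S] {c : ℂ} {b b' g : S}
    (h : (b - b') * g = 0) : (c • b - c • b') * g = 0 := by
  rw [← smul_sub, smul_mul_assoc, h, smul_zero]

lemma psi_isDGMorphism {dXi : Xi n →ₗ[ℂ] Xi n} {dE : E2 τ n →ₗ[ℂ] E2 τ n}
    (hXi : Xi.IsDifferential n dXi) (hE : IsDifferential τ n dE) :
    IsDGMorphism (Xi.grading n) dXi (grading τ n) dE (psi τ n) := by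
  have hpull : ∀ (i : Fin n) (η : cohPiece τ 1), dE (pull i η) = 0 := fun i η =>
    derivation_values hE (.pull i 1 η)
  have hnu : ∀ i : Fin n, psi τ n (Xi.nu i) = psiGen τ n (.nu i) := fun i => psi_gen _
  have homm : ∀ (i j : Fin n) m, psi τ n (Xi.omm i j m) = ommSeq τ n i j m := fun i j m =>
    psi_gen (.omm i j m)
  refine isDGMorphism_of_gen hXi.isCDGA hE.isCDGA
    (fun x => by rw [psi_gen]; exact psiGen_mem x) (fun x => ?_)
  rw [Xi.derivation_values hXi, psi_gen]
  match x with
  | .om i => rw [Xi.dGen, map_zero, psiGen, hpull]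
  | .nu i => rw [Xi.dGen, map_zero, psiGen, map_smul, hpull, smul_zero]
  | .omm i j 0 =>
    rw [Xi.dGen, map_zero, psiGen, ommSeq, linSeq, map_sub, hpull, hpull, sub_zero]
  | .omm i j 1 =>
    have hG : dE (G τ i j) = diag τ i j := by
      by_cases hij : i = j
      · rw [hij, diag_self]
        change dE (TotaroAlg.G (cohPiece τ) j j) = 0
        rw [TotaroAlg.G_self, map_zero]
      · exact hE.d_G i j hij
    rw [Xi.dGen, map_mul, map_sub, hnu, hnu, homm, psiGen, psiGen, psiGen, ommSeq, linSeq, linSeq,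
      hG]
    exact sub_mul_sub_anticomm
      (mul_anticomm_of_mem (pull_sub_pull_mem i j _) (pull_sub_pull_mem i j _))
  | .omm i j 2 =>
    rw [Xi.dGen, map_mul, map_sub, hnu, hnu, homm, psiGen, psiGen, psiGen, ommSeq]
    refine Eq.trans ?_ (map_zero dE).symm
    -- ψ kills ω_ij^{(2)}, so the image of (ν_i - ν_j)ω_ij^{(1)} must vanish; it is a multiple of
    -- ([dx̄_i] - [dx̄_j])G_ij, a relation of E_2(n).
    exact smul_sub_smul_mul_eq_zero (pull_sub_pull_mul_G i j (dxbar τ))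
  | .omm i j (m + 3) =>
    rw [Xi.dGen, map_mul, homm]
    refine Eq.trans ?_ (map_zero dE).symm
    exact mul_zero _

end E2

end ChiralHodge

end

/-! ### The proposition -/

theorem mainTheorem6 (τ : UpperHalfPlane) (n : ℕ) :
    (∃! d : ChiralHodge.Xi n →ₗ[ℂ] ChiralHodge.Xi n, ChiralHodge.Xi.IsDifferential n d) ∧
    (∃! d : ChiralHodge.E2 τ n →ₗ[ℂ] ChiralHodge.E2 τ n, ChiralHodge.E2.IsDifferential τ n d) ∧
    ∀ (dXi : ChiralHodge.Xi n →ₗ[ℂ] ChiralHodge.Xi n)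
      (dE : ChiralHodge.E2 τ n →ₗ[ℂ] ChiralHodge.E2 τ n),
      ChiralHodge.Xi.IsDifferential n dXi → ChiralHodge.E2.IsDifferential τ n dE →
      ∃! ψ : ChiralHodge.Xi n →ₐ[ℂ] ChiralHodge.E2 τ n,
        ChiralHodge.IsDGMorphism (ChiralHodge.Xi.grading n) dXi (ChiralHodge.E2.grading τ n) dE ψ ∧
        (∀ i : Fin n, ψ (ChiralHodge.Xi.nu i) =
          (-(1 / ((starRingEnd ℂ) (τ : ℂ) - (τ : ℂ)))) •
            ChiralHodge.E2.pull i (ChiralHodge.dxbar τ)) ∧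
        (∀ i : Fin n, ψ (ChiralHodge.Xi.om i) = ChiralHodge.E2.pull i (ChiralHodge.dx τ)) ∧
        (∀ i j : Fin n, ψ (ChiralHodge.Xi.omm i j 0) =
          ChiralHodge.E2.pull i (ChiralHodge.dx τ) - ChiralHodge.E2.pull j (ChiralHodge.dx τ)) ∧
        (∀ i j : Fin n, ψ (ChiralHodge.Xi.omm i j 1) = ChiralHodge.E2.G τ i j) ∧
        (∀ (i j : Fin n) (m : ℕ), 2 ≤ m → ψ (ChiralHodge.Xi.omm i j m) = 0) := by
  refine ⟨ChiralHodge.Xi.existsUnique_differential, ChiralHodge.E2.existsUnique_differential,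
    fun dXi dE hXi hE => ⟨ChiralHodge.E2.psi τ n,
      ⟨ChiralHodge.E2.psi_isDGMorphism hXi hE, fun i => ChiralHodge.E2.psi_gen (.nu i),
        fun i => ChiralHodge.E2.psi_gen (.om i), fun i j => ChiralHodge.E2.psi_gen (.omm i j 0),
        fun i j => ChiralHodge.E2.psi_gen (.omm i j 1), fun i j m hm => ?_⟩, ?_⟩⟩
  · obtain ⟨m, rfl⟩ := Nat.exists_eq_add_of_le' hm
    exact ChiralHodge.E2.psi_gen (.omm i j (m + 2))
  · rintro ψ ⟨-, hnu, hom, h0, h1, h2⟩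
    refine ChiralHodge.GCAlg.algHom_ext fun x => ?_
    rw [ChiralHodge.E2.psi_gen]
    match x with
    | .nu i => exact hnu i
    | .om i => exact hom i
    | .omm i j 0 => exact h0 i j
    | .omm i j 1 => exact h1 i j
    | .omm i j (m + 2) => exact h2 i j (m + 2) (Nat.le_add_left 2 m)
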